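/- Let $\mathcal X$ be a measurable space with countably generated $\sigma$-algebra. For a probability measure $\pi$ on $\mathcal X$, let $L_2(\pi)$ be the space of finite signed measures $\nu\ll\pi$ with $\|\nu\|_{L_2(\pi)}:=\big(\int (d\nu/d\pi)^2\,d\pi\big)^{1/2}<\infty$, and let $\|h\|_{p,\pi}:=(\int|h|^p\,d\pi)^{1/p}$ for functions $h$. A Markov kernel $P$ acts on signed measures by $(\nu P)(A)=\int P(x,A)\,\nu(dx)$; write $\pi f=\int f\,d\pi$ and $\mu P^m f=\int f\,d(\mu P^m)$. Let $P$ be a Markov kernel on $\mathcal X$, reversible with respect to a probability measure $\pi$, and $L_2(\pi)$-geometrically ergodic with rate $1-\alpha$, $0<\alpha<1$: for every probability measure $\mu\in L_2(\pi)$ there is $C_\mu<\infty$ with $\|\mu P^n-\pi\|_{L_2(\pi)}\le C_\mu(1-\alpha)^n$ for all $n\ge 0$. (1) Let $f:\mathcal X\to\mathbb R$ satisfy $\|f\|_{4,\pi}<\infty$, and let $(X_n)_{n\ge0}$ be a Markov chain with kernel $P$ started from a probability measure $\mu\in L_2(\pi)$. Then every $f(X_m)$ is square-integrable, and for every integer $t\ge1$,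 $$\frac1{t^2}\sum_{m=0}^{t-1}\sum_{n=0}^{t-1}\operatorname{Cov}\big(f(X_m),f(X_n)\big)\le \frac{2\|f-\pi f\|_{2,\pi}^2}{\alpha t}+\frac{2^{7/2}\,\|\mu-\pi\|_{L_2(\pi)}\,\|f-\pi f\|_{4,\pi}^2}{\alpha^2t^2}-\Big(\frac1t\sum_{m=0}^{t-1}\mu P^mf-\pi f\Big)^2 .$$ (2) Let $\epsilon>0$ and let $P_\epsilon$ be a second Markov kernel such that $\nu\mapsto\nu P-\nu P_\epsilon$ is a bounded operator on $L_2(\pi)$ of norm at most $\epsilon$, with a stationary probability measure $\pi_\epsilon\ll\pi$. Suppose that $\epsilon<\alpha$, $\pi\ll\pi_\epsilon$, $\pi_\epsilon\in L_2(\pi)$, and that $P_\epsilon$ is reversible with respect to $\pi_\epsilon$. Let $g:\mathcal X\to\mathbb R$ satisfy $\|g\|_{4,\pi_\epsilon}<\infty$, and let $(X^\epsilon_n)_{n\ge0}$ be a Markov chain with kernel $P_\epsilon$ started from a probability measure $\nu\in L_2(\pi_\epsilon)$. Then every $g(X^\epsilon_m)$ is square-integrable, and for every integer $t\ge1$, $$\frac1{t^2}\sum_{m=0}^{t-1}\sum_{n=0}^{t-1}\operatorname{Cov}\big(g(X^\epsilon_m),g(X^\epsilon_n)\big)\le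 \frac{2\|g-\pi_\epsilon g\|_{2,\pi_\epsilon}^2}{(\alpha-\epsilon) t}+\frac{2^{7/2}\,\|\nu-\pi_\epsilon\|_{L_2(\pi_\epsilon)}\,\|g-\pi_\epsilon g\|_{4,\pi_\epsilon}^2}{(\alpha-\epsilon)^2t^2}-\Big(\frac1t\sum_{m=0}^{t-1}\nu P_\epsilon^mg-\pi_\epsilon g\Big)^2 .$$ -/

import Mathlib

open MeasureTheory ProbabilityTheory

noncomputable section

namespace PerturbedChain

variable {𝒳 : Type*} [MeasurableSpace 𝒳]

/-- The `n`-step transition kernel `P ^ n` of a Markov kernel is a Markov kernel. -/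
instance isMarkovKernel_pow (P : Kernel 𝒳 𝒳) [IsMarkovKernel P] (n : ℕ) :
    IsMarkovKernel (P ^ n) := by
  induction n with
  | zero =>
    rw [pow_zero]
    exact inferInstanceAs (IsMarkovKernel (Kernel.id : Kernel 𝒳 𝒳))
  | succ n ih =>
    rw [pow_succ]
    exact inferInstanceAs (IsMarkovKernel ((P ^ n) ∘ₖ P))

/-- `ν ∈ L₂(π)` for a signed measure `ν`: it is absolutely continuous with respect to `π`
and its density `dν/dπ` is square-integrable with respect to `π`. -/
def MemL2 (π : Measure 𝒳) (ν : SignedMeasure 𝒳) : Prop :=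
  ν ≪ᵥ π.toENNRealVectorMeasure ∧ MemLp (ν.rnDeriv π) 2 π

/-- The norm `‖ν‖ = (∫ (dν/dπ)² dπ)^(1/2)` of a signed measure `ν ∈ L₂(π)`. -/
def l2Norm (π : Measure 𝒳) (ν : SignedMeasure 𝒳) : ℝ :=
  lpNorm (ν.rnDeriv π) 2 π

/-- The action `ν ↦ ν P`, `(ν P)(A) = ∫ P(x, A) ν(dx)`, of a Markov kernel on signed measures,
through the Jordan decomposition of `ν`. -/
def signedBind (ν : SignedMeasure 𝒳) (P : Kernel 𝒳 𝒳) [IsMarkovKernel P] : SignedMeasure 𝒳 :=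
  (P ∘ₘ ν.toJordanDecomposition.posPart).toSignedMeasure -
    (P ∘ₘ ν.toJordanDecomposition.negPart).toSignedMeasure

/-- The operator `ν ↦ ν P - ν Q` maps `L₂(π)` to itself, with operator norm at most `ε`. -/
def OpNormSubLE (π : Measure 𝒳) (P Q : Kernel 𝒳 𝒳) [IsMarkovKernel P] [IsMarkovKernel Q]
    (ε : ℝ) : Prop :=
  ∀ ν : SignedMeasure 𝒳, MemL2 π ν →
    MemL2 π (signedBind ν P - signedBind ν Q) ∧
      l2Norm π (signedBind ν P - signedBind ν Q) ≤ ε * l2Norm π ν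

/-- `P` is `L₂(π)`-geometrically ergodic with rate `ρ`: for every probability measure
`μ ∈ L₂(π)` there is a finite constant `C` with `‖μ Pⁿ - π‖ ≤ C ρⁿ` in `L₂(π)` for all `n`. -/
def IsL2GeomErgodic (P : Kernel 𝒳 𝒳) [IsMarkovKernel P] (π : Measure 𝒳) [IsProbabilityMeasure π]
    (ρ : ℝ) : Prop :=
  ∀ (μ : Measure 𝒳) [IsProbabilityMeasure μ], MemL2 π μ.toSignedMeasure →
    ∃ C : ℝ, ∀ n : ℕ,
      MemL2 π (((P ^ n) ∘ₘ μ).toSignedMeasure - π.toSignedMeasure) ∧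
        l2Norm π (((P ^ n) ∘ₘ μ).toSignedMeasure - π.toSignedMeasure) ≤ C * ρ ^ n

/-- `X` is a (time-homogeneous) Markov chain on the probability space `(Ω, Pr)` with
transition kernel `P` and initial distribution `μ`: given `X 0, …, X n`, the conditional
distribution of `X (n + 1)` is `P (X n, ·)`. -/
structure IsMarkovChain {Ω : Type*} [MeasurableSpace Ω] (Pr : Measure Ω) (P : Kernel 𝒳 𝒳)
    (μ : Measure 𝒳) (X : ℕ → Ω → 𝒳) : Prop where
  measurable : ∀ n, Measurable (X n)
  initial : HasLaw (X 0) μ Pr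
  step : ∀ n : ℕ, HasCondDistrib (X (n + 1)) (fun ω (i : Finset.Iic n) => X i ω)
    (P.comap (fun x : Finset.Iic n → 𝒳 => x ⟨n, Finset.mem_Iic.2 le_rfl⟩)
      (measurable_pi_apply _)) Pr

end PerturbedChain

end

/-!
# Mean square error of ergodic averages for perturbed reversible chains

Let `P` be reversible with respect to `π`. As an operator on functions, `P` is self-adjoint on
`L²(π)`, hence `n ↦ ‖Pⁿ h‖` is log-convex: successive ratios do not decrease, so a bound
`‖Pⁿ h‖ ≤ C_h ρⁿ` with any constant already gives `‖P h‖ ≤ ρ ‖h‖`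
(`lpNorm_kernelOp_le_of_decay`). As bounded functions are dense, it is enough to have such bounds
for bounded mean-zero `h` (`hasL2Gap_of_bounded_decay`). No spectral theorem is involved.

This is used twice. A bounded mean-zero `h` is, up to scaling, a probability density minus `1`, so
geometric ergodicity yields the gap `α` for `P` (`hasL2Gap_of_isL2GeomErgodic`). For the
perturbed kernel, `ν ↦ ν Pε` contracts the mean-zero part of `L₂(π)` by `1 - α + ε`; although this
norm is not the one of `L²(πε)`, pairing `(h πε) Pε²ⁿ` with a bounded `h` gives
`‖Pεⁿ h‖² ≤ C_h (1 - α + ε)²ⁿ` in `L²(πε)`, and hence the gap `α - ε` for `Pε`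
(`hasL2Gap_of_opNormSubLE`). Both claims are thus instances of one bound for a reversible kernel
with a gap (`memLp_and_sum_covariance_le`).

For that bound, let `f` be centred, let `μ = (1 + h) π` be the initial law and `ρ = 1 - α`. Then
`E[f(X_m) f(X_{m+k})] = ∫ f · Pᵏf dπ + ∫ f · Pᵏf · Pᵐh dπ`. The first term is at most
`ρᵏ ‖f‖₂²`. The second is at most `‖f · Pᵏf‖₂ ρᵐ ‖h‖₂`, and `‖f · Pᵏf‖₂ ≤ √2 ρ^(k/2) ‖f‖₄²` by an
elementary argument from Jensen's inequality (`HasL2Gap.lpNorm_sq_kernelOp_pow_le`) in place of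
Riesz–Thorin interpolation. Summing the geometric series gives the claim, the constant of the
second term even with a factor `2` to spare.
-/

noncomputable section

namespace PerturbedChain

variable {𝒳 : Type*} [MeasurableSpace 𝒳]

/-! ### Reversible kernels as self-adjoint operators -/

/-- The action `(Q f)(x) = ∫ f(y) Q(x, dy)` of a kernel on functions. -/
def kernelOp (Q : Kernel 𝒳 𝒳) (f : 𝒳 → ℝ) : 𝒳 → ℝ := fun x => ∫ y, f y ∂(Q x)

lemma measurable_kernelOp (Q : Kernel 𝒳 𝒳) {f : 𝒳 → ℝ} (hf : Measurable f) :
    Measurable (kernelOp Q f) :=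
  (hf.stronglyMeasurable.integral_kernel (κ := Q)).measurable

/-- Reversibility says that the law `π(dx) Q(x, dy)` of one stationary step is symmetric. -/
lemma map_swap_compProd {Q : Kernel 𝒳 𝒳} [IsMarkovKernel Q] {π : Measure 𝒳}
    [IsProbabilityMeasure π] (h : Q.IsReversible π) :
    (π ⊗ₘ Q).map Prod.swap = π ⊗ₘ Q := by
  have : IsProbabilityMeasure ((π ⊗ₘ Q).map Prod.swap) :=
    Measure.isProbabilityMeasure_map measurable_swap.aemeasurable
  refine Measure.ext_prod fun {s t} hs ht => ?_
  rw [Measure.map_apply measurable_swap (hs.prod ht), Set.preimage_swap_prod,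
    Measure.compProd_apply_prod ht hs, Measure.compProd_apply_prod hs ht]
  exact h ht hs

lemma comp_eq_of_isReversible {Q : Kernel 𝒳 𝒳} [IsMarkovKernel Q] {π : Measure 𝒳}
    (h : Q.IsReversible π) : Q ∘ₘ π = π := h.invariant

lemma measurePreserving_fst_compProd (Q : Kernel 𝒳 𝒳) [IsMarkovKernel Q] (π : Measure 𝒳)
    [IsProbabilityMeasure π] : MeasurePreserving Prod.fst (π ⊗ₘ Q) π :=
  ⟨measurable_fst, Measure.fst_compProd π Q⟩

lemma measurePreserving_snd_compProd {Q : Kernel 𝒳 𝒳} [IsMarkovKernel Q] {π : Measure 𝒳}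
    [IsProbabilityMeasure π] (h : Q.IsReversible π) :
    MeasurePreserving Prod.snd (π ⊗ₘ Q) π :=
  ⟨measurable_snd, (Measure.snd_compProd π Q).trans (comp_eq_of_isReversible h)⟩

/-- A reversible kernel is self-adjoint for the pairing of extended nonnegative functions. -/
lemma lintegral_mul_lintegral_comm {Q : Kernel 𝒳 𝒳} [IsMarkovKernel Q] {π : Measure 𝒳}
    [IsProbabilityMeasure π] (h : Q.IsReversible π) {f g : 𝒳 → ENNReal} (hf : Measurable f)
    (hg : Measurable g) :
    ∫⁻ x, f x * ∫⁻ y, g y ∂(Q x) ∂π = ∫⁻ x, g x * ∫⁻ y, f y ∂(Q x) ∂π := by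
  have key : ∀ {u v : 𝒳 → ENNReal}, Measurable u → Measurable v →
      ∫⁻ p, u p.1 * v p.2 ∂(π ⊗ₘ Q) = ∫⁻ x, u x * ∫⁻ y, v y ∂(Q x) ∂π := by
    intro u v hu hv
    rw [Measure.lintegral_compProd (by fun_prop)]
    refine lintegral_congr fun x => ?_
    dsimp only
    rw [lintegral_const_mul _ hv]
  rw [← key hf hg, ← key hg hf, ← map_swap_compProd h, lintegral_map (by fun_prop) measurable_swap]
  conv_rhs => rw [map_swap_compProd h]
  simp [mul_comm]

lemma isReversible_pow {P : Kernel 𝒳 𝒳} [IsMarkovKernel P] {π : Measure 𝒳}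
    [IsProbabilityMeasure π] (h : P.IsReversible π) (n : ℕ) : (P ^ n).IsReversible π := by
  induction n with
  | zero =>
    intro A B hA hB
    change ∫⁻ x in A, Kernel.id x B ∂π = ∫⁻ x in B, Kernel.id x A ∂π
    simp only [Kernel.id_apply, Measure.dirac_apply' _ hB, Measure.dirac_apply' _ hA]
    rw [lintegral_indicator_one hB, lintegral_indicator_one hA, Measure.restrict_apply hB,
      Measure.restrict_apply hA, Set.inter_comm]
  | succ n ih =>
    intro A B hA hB
    have key : ∀ (κ : Kernel 𝒳 𝒳) {A : Set 𝒳}, MeasurableSet A → ∫⁻ x in A, κ x B ∂π =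
        ∫⁻ x, A.indicator 1 x * κ x B ∂π := by
      intro κ A hA
      rw [← lintegral_indicator hA]
      refine lintegral_congr fun x => ?_
      by_cases hx : x ∈ A <;> simp [hx]
    have e1 : ∫⁻ x in A, (P ^ (n + 1)) x B ∂π =
        ∫⁻ x, A.indicator 1 x * ∫⁻ y, (P ^ n) y B ∂(P x) ∂π := by
      rw [key _ hA]
      refine lintegral_congr fun x => ?_
      rw [pow_succ]
      exact congrArg _ (Kernel.comp_apply' _ _ _ hB)
    have e2 : ∫⁻ x in B, (P ^ (n + 1)) x A ∂π =
        ∫⁻ x, B.indicator 1 x * ∫⁻ y, P y A ∂((P ^ n) x) ∂π := by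
      rw [← lintegral_indicator hB]
      refine lintegral_congr fun x => ?_
      rw [pow_succ']
      by_cases hx : x ∈ B
      · simp only [Set.indicator_of_mem hx, Pi.one_apply, one_mul]
        exact Kernel.comp_apply' _ _ _ hA
      · simp [hx]
    rw [e1, e2, lintegral_mul_lintegral_comm h (measurable_one.indicator hA)
      (Kernel.measurable_coe _ hB), lintegral_mul_lintegral_comm ih (measurable_one.indicator hB)
      (Kernel.measurable_coe _ hA)]
    refine lintegral_congr fun x => ?_
    rw [lintegral_indicator_one hA, lintegral_indicator_one hB, mul_comm]

lemma integrable_mul_compProd {Q : Kernel 𝒳 𝒳} [IsMarkovKernel Q] {π : Measure 𝒳}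
    [IsProbabilityMeasure π] (h : Q.IsReversible π) {f g : 𝒳 → ℝ} (hf : MemLp f 2 π)
    (hg : MemLp g 2 π) : Integrable (fun p : 𝒳 × 𝒳 => f p.1 * g p.2) (π ⊗ₘ Q) :=
  (hf.comp_measurePreserving (measurePreserving_fst_compProd Q π)).integrable_mul
    (hg.comp_measurePreserving (measurePreserving_snd_compProd h))

/-- A reversible kernel is a self-adjoint operator on `L²`. -/
lemma integral_mul_kernelOp_comm {Q : Kernel 𝒳 𝒳} [IsMarkovKernel Q] {π : Measure 𝒳}
    [IsProbabilityMeasure π] (h : Q.IsReversible π) {f g : 𝒳 → ℝ} (hf : MemLp f 2 π)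
    (hg : MemLp g 2 π) :
    ∫ x, f x * kernelOp Q g x ∂π = ∫ x, kernelOp Q f x * g x ∂π := by
  have key : ∀ {u v : 𝒳 → ℝ}, MemLp u 2 π → MemLp v 2 π →
      ∫ p, u p.1 * v p.2 ∂(π ⊗ₘ Q) = ∫ x, u x * kernelOp Q v x ∂π := by
    intro u v hu hv
    rw [Measure.integral_compProd (integrable_mul_compProd h hu hv)]
    refine integral_congr_ae (ae_of_all _ fun x => ?_)
    dsimp only [kernelOp]
    rw [integral_const_mul]
  have e : ∫ p, f p.1 * g p.2 ∂(π ⊗ₘ Q) = ∫ p, g p.1 * f p.2 ∂(π ⊗ₘ Q) := by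
    conv_lhs => rw [← map_swap_compProd h]
    rw [integral_map measurable_swap.aemeasurable
      (by rw [map_swap_compProd h]; exact (integrable_mul_compProd h hf hg).1)]
    simp [mul_comm]
  rw [← key hf hg, e, key hg hf]
  simp [mul_comm]

/-- Jensen's inequality: a Markov kernel contracts every `Lᵖ` norm with respect to an invariant
measure. -/
lemma eLpNorm_kernelOp_le {Q : Kernel 𝒳 𝒳} [IsMarkovKernel Q] {π : Measure 𝒳}
    [IsProbabilityMeasure π] (h : Q.IsReversible π) {f : 𝒳 → ℝ} (hf : Measurable f)
    {p : ENNReal} (hp : 1 ≤ p) (hp' : p ≠ ⊤) :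
    eLpNorm (kernelOp Q f) p π ≤ eLpNorm f p π := by
  have hp0 : p ≠ 0 := (zero_lt_one.trans_le hp).ne'
  have hpr : 0 < p.toReal := ENNReal.toReal_pos hp0 hp'
  rw [eLpNorm_eq_lintegral_rpow_enorm_toReal hp0 hp',
    eLpNorm_eq_lintegral_rpow_enorm_toReal hp0 hp']
  refine ENNReal.rpow_le_rpow ?_ (by positivity)
  have e : ∫⁻ x, ‖f x‖ₑ ^ p.toReal ∂π = ∫⁻ x, ∫⁻ y, ‖f y‖ₑ ^ p.toReal ∂(Q x) ∂π := by
    conv_lhs => rw [← comp_eq_of_isReversible h]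
    rw [Measure.lintegral_bind Q.aemeasurable (by fun_prop)]
  rw [e]
  refine lintegral_mono fun x => ?_
  have h1 : ‖kernelOp Q f x‖ₑ ≤ eLpNorm f p (Q x) := by
    refine (enorm_integral_le_lintegral_enorm _).trans ?_
    rw [← eLpNorm_one_eq_lintegral_enorm]
    exact eLpNorm_le_eLpNorm_of_exponent_le hp hf.aestronglyMeasurable
  refine (ENNReal.rpow_le_rpow h1 hpr.le).trans ?_
  rw [eLpNorm_eq_lintegral_rpow_enorm_toReal hp0 hp', ← ENNReal.rpow_mul, one_div,
    inv_mul_cancel₀ hpr.ne', ENNReal.rpow_one]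

lemma memLp_kernelOp {Q : Kernel 𝒳 𝒳} [IsMarkovKernel Q] {π : Measure 𝒳}
    [IsProbabilityMeasure π] (h : Q.IsReversible π) {f : 𝒳 → ℝ} (hfm : Measurable f)
    {p : ENNReal} (hp : 1 ≤ p) (hp' : p ≠ ⊤) (hf : MemLp f p π) : MemLp (kernelOp Q f) p π :=
  ⟨(measurable_kernelOp Q hfm).aestronglyMeasurable,
    (eLpNorm_kernelOp_le h hfm hp hp').trans_lt hf.2⟩

lemma lpNorm_kernelOp_le {Q : Kernel 𝒳 𝒳} [IsMarkovKernel Q] {π : Measure 𝒳}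
    [IsProbabilityMeasure π] (h : Q.IsReversible π) {f : 𝒳 → ℝ} (hfm : Measurable f)
    {p : ENNReal} (hp : 1 ≤ p) (hp' : p ≠ ⊤) (hf : MemLp f p π) :
    lpNorm (kernelOp Q f) p π ≤ lpNorm f p π := by
  rw [← toReal_eLpNorm hf.1, ← toReal_eLpNorm (measurable_kernelOp Q hfm).aestronglyMeasurable]
  exact ENNReal.toReal_mono hf.2.ne (eLpNorm_kernelOp_le h hfm hp hp')

lemma ae_integrable_kernel {Q : Kernel 𝒳 𝒳} [IsMarkovKernel Q] {π : Measure 𝒳}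
    (h : Q.IsReversible π) {f : 𝒳 → ℝ} (hf : Integrable f π) : ∀ᵐ x ∂π, Integrable f (Q x) :=
  Measure.ae_integrable_of_integrable_comp (by rwa [comp_eq_of_isReversible h])

lemma kernelOp_pow_add {P : Kernel 𝒳 𝒳} [IsMarkovKernel P] {π : Measure 𝒳}
    [IsProbabilityMeasure π] (h : P.IsReversible π) {f : 𝒳 → ℝ} (hf : Integrable f π) (m n : ℕ) :
    kernelOp (P ^ (m + n)) f =ᵐ[π] kernelOp (P ^ m) (kernelOp (P ^ n) f) := by
  filter_upwards [ae_integrable_kernel (isReversible_pow h (m + n)) hf] with x hx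
  rw [add_comm, pow_add] at hx
  rw [kernelOp, add_comm, pow_add]
  exact Kernel.integral_comp hx

@[simp] lemma kernelOp_one {f : 𝒳 → ℝ} (hf : Measurable f) :
    kernelOp (1 : Kernel 𝒳 𝒳) f = f := by
  ext x
  change ∫ y, f y ∂(Kernel.id x) = f x
  rw [Kernel.id_apply, integral_dirac' _ _ hf.stronglyMeasurable]

lemma integral_kernelOp {Q : Kernel 𝒳 𝒳} [IsMarkovKernel Q] {π : Measure 𝒳}
    [IsProbabilityMeasure π] (h : Q.IsReversible π) {f : 𝒳 → ℝ} (hf : MemLp f 2 π) :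
    ∫ x, kernelOp Q f x ∂π = ∫ x, f x ∂π := by
  have := integral_mul_kernelOp_comm h (memLp_const (1 : ℝ)) hf
  simpa [kernelOp] using this

lemma kernelOp_sub {Q : Kernel 𝒳 𝒳} [IsMarkovKernel Q] {π : Measure 𝒳}
    [IsProbabilityMeasure π] (h : Q.IsReversible π) {f g : 𝒳 → ℝ} (hf : Integrable f π)
    (hg : Integrable g π) :
    kernelOp Q (f - g) =ᵐ[π] kernelOp Q f - kernelOp Q g := by
  filter_upwards [ae_integrable_kernel h hf, ae_integrable_kernel h hg] with x h1 h2
  exact integral_sub h1 h2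

/-- The pairing of two iterates depends only on the total number of steps. -/
lemma integral_kernelOp_pow_mul {P : Kernel 𝒳 𝒳} [IsMarkovKernel P] {π : Measure 𝒳}
    [IsProbabilityMeasure π] (h : P.IsReversible π) {f g : 𝒳 → ℝ}
    (hf : MemLp f 2 π) (hgm : Measurable g) (hg : MemLp g 2 π) (m n : ℕ) :
    ∫ x, kernelOp (P ^ m) f x * kernelOp (P ^ n) g x ∂π =
      ∫ x, f x * kernelOp (P ^ (m + n)) g x ∂π := by
  rw [← integral_mul_kernelOp_comm (isReversible_pow h m) hf
    (memLp_kernelOp (isReversible_pow h n) hgm (by norm_num) (by norm_num) hg)]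
  refine integral_congr_ae ?_
  filter_upwards [kernelOp_pow_add h (hg.integrable (by norm_num)) m n] with x hx
  rw [hx]

lemma lpNorm_congr_ae {π : Measure 𝒳} {f g : 𝒳 → ℝ} {p : ENNReal} (h : f =ᵐ[π] g) :
    lpNorm f p π = lpNorm g p π := by
  by_cases hf : AEStronglyMeasurable f π
  · rw [← toReal_eLpNorm hf, ← toReal_eLpNorm (hf.congr h), eLpNorm_congr_ae h]
  · rw [lpNorm_of_not_aestronglyMeasurable hf,
      lpNorm_of_not_aestronglyMeasurable fun hg => hf (hg.congr h.symm)]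

lemma sq_lpNorm_two {π : Measure 𝒳} {f : 𝒳 → ℝ} (hf : AEStronglyMeasurable f π) :
    lpNorm f 2 π ^ 2 = ∫ x, f x ^ 2 ∂π := by
  rw [lpNorm_eq_integral_norm_rpow_toReal (by norm_num) (by norm_num) hf, ← Real.rpow_natCast,
    ← Real.rpow_mul (integral_nonneg fun x => by positivity)]
  simp

lemma abs_integral_mul_le {π : Measure 𝒳} {f g : 𝒳 → ℝ} (hf : MemLp f 2 π) (hg : MemLp g 2 π) :
    |∫ x, f x * g x ∂π| ≤ lpNorm f 2 π * lpNorm g 2 π := by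
  have h2 : (2 : ENNReal) = ENNReal.ofReal 2 := by simp
  refine (abs_integral_le_integral_abs).trans ?_
  have := integral_mul_norm_le_Lp_mul_Lq (μ := π) (f := f) (g := g)
    (Real.holderConjugate_iff.2 ⟨by norm_num, by norm_num⟩ : (2 : ℝ).HolderConjugate 2)
    (h2 ▸ hf) (h2 ▸ hg)
  rw [lpNorm_eq_integral_norm_rpow_toReal (by norm_num) (by norm_num) hf.1,
    lpNorm_eq_integral_norm_rpow_toReal (by norm_num) (by norm_num) hg.1]
  simpa [abs_mul] using this

/-! ### Spectral gaps from decay of bounded functions -/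

/-- A log-convex sequence has nondecreasing successive ratios, so a geometric bound with an
arbitrary constant already bounds its first ratio. -/
lemma le_mul_of_logConvex {a : ℕ → ℝ} {ρ C : ℝ} (hρ : 0 < ρ) (ha : ∀ n, 0 ≤ a n)
    (hconv : ∀ n, a (n + 1) ^ 2 ≤ a n * a (n + 2)) (hC : ∀ n, a n ≤ C * ρ ^ n) :
    a 1 ≤ ρ * a 0 := by
  by_contra! hlt
  have h1 : 0 < a 1 := (mul_nonneg hρ.le (ha 0)).trans_lt hlt
  have h0 : 0 < a 0 := by
    rcases (ha 0).eq_or_lt with h | h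
    · have := hconv 0
      rw [← h, zero_mul] at this
      nlinarith
    · exact h
  set r := a 1 / a 0 with hr
  have hr0 : 0 < r := div_pos h1 h0
  have hstep : ∀ n, 0 < a n ∧ r * a n ≤ a (n + 1) := by
    intro n
    induction n with
    | zero => exact ⟨h0, (div_mul_cancel₀ _ h0.ne').le⟩
    | succ n ih =>
      have hpos : 0 < a (n + 1) := (mul_pos hr0 ih.1).trans_le ih.2
      refine ⟨hpos, le_of_mul_le_mul_left ?_ ih.1⟩
      calc a n * (r * a (n + 1)) = (r * a n) * a (n + 1) := by ring
        _ ≤ a (n + 1) * a (n + 1) := mul_le_mul_of_nonneg_right ih.2 hpos.le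
        _ = a (n + 1) ^ 2 := by ring
        _ ≤ a n * a (n + 2) := hconv n
  have hlow : ∀ n, r ^ n * a 0 ≤ a n := by
    intro n
    induction n with
    | zero => simp
    | succ n ih =>
      calc r ^ (n + 1) * a 0 = r * (r ^ n * a 0) := by ring
        _ ≤ r * a n := mul_le_mul_of_nonneg_left ih hr0.le
        _ ≤ a (n + 1) := (hstep n).2
  have hrρ : 1 < r / ρ := by
    rw [one_lt_div hρ, hr, lt_div_iff₀ h0]
    exact hlt
  obtain ⟨n, hn⟩ := pow_unbounded_of_one_lt (C / a 0) hrρ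
  rw [div_pow, div_lt_div_iff₀ h0 (pow_pos hρ n)] at hn
  exact absurd ((hlow n).trans (hC n)) (not_le.2 hn)

/-- `Q` contracts the mean-zero part of `L²(π)` by the factor `ρ`: the spectral gap of `Q` is
at least `1 - ρ`. -/
def HasL2Gap (Q : Kernel 𝒳 𝒳) (π : Measure 𝒳) (ρ : ℝ) : Prop :=
  ∀ h : 𝒳 → ℝ, Measurable h → MemLp h 2 π → ∫ x, h x ∂π = 0 →
    lpNorm (kernelOp Q h) 2 π ≤ ρ * lpNorm h 2 π

lemma sq_lpNorm_kernelOp_pow {P : Kernel 𝒳 𝒳} [IsMarkovKernel P] {π : Measure 𝒳}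
    [IsProbabilityMeasure π] (hrev : P.IsReversible π) {h : 𝒳 → ℝ} (hm : Measurable h)
    (h2 : MemLp h 2 π) (n : ℕ) :
    lpNorm (kernelOp (P ^ n) h) 2 π ^ 2 = ∫ x, h x * kernelOp (P ^ (2 * n)) h x ∂π := by
  rw [sq_lpNorm_two (measurable_kernelOp _ hm).aestronglyMeasurable, two_mul,
    ← integral_kernelOp_pow_mul hrev h2 hm h2]
  simp only [sq]

/-- For a reversible kernel `n ↦ ‖Pⁿ h‖` is log-convex, so geometric decay of this sequence at
rate `ρ` forces `‖P h‖ ≤ ρ ‖h‖`, whatever the constant. -/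
lemma lpNorm_kernelOp_le_of_decay {P : Kernel 𝒳 𝒳} [IsMarkovKernel P] {π : Measure 𝒳}
    [IsProbabilityMeasure π] (hrev : P.IsReversible π) {ρ : ℝ} (hρ : 0 < ρ) {h : 𝒳 → ℝ}
    (hm : Measurable h) (h2 : MemLp h 2 π) {C : ℝ}
    (hC : ∀ n, ∫ x, h x * kernelOp (P ^ (2 * n)) h x ∂π ≤ C * ρ ^ (2 * n)) :
    lpNorm (kernelOp P h) 2 π ≤ ρ * lpNorm h 2 π := by
  have hK : ∀ n, MemLp (kernelOp (P ^ n) h) 2 π := fun n =>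
    memLp_kernelOp (isReversible_pow hrev n) hm (by norm_num) (by norm_num) h2
  have := le_mul_of_logConvex (a := fun n => lpNorm (kernelOp (P ^ n) h) 2 π) (C := √C) hρ
    (fun n => lpNorm_nonneg) (fun n => ?_) (fun n => ?_)
  · simpa [hm] using this
  · rw [sq_lpNorm_kernelOp_pow hrev hm h2, show 2 * (n + 1) = n + (n + 2) by ring,
      ← integral_kernelOp_pow_mul hrev h2 hm h2]
    exact (le_abs_self _).trans (abs_integral_mul_le (hK n) (hK (n + 2)))
  · refine (pow_le_pow_iff_left₀ lpNorm_nonneg (by positivity) (by norm_num : 2 ≠ 0)).1 ?_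
    have hC0 : 0 ≤ C := by
      have := (sq_nonneg _).trans ((sq_lpNorm_kernelOp_pow hrev hm h2 0).le.trans (hC 0))
      simpa using this
    rw [sq_lpNorm_kernelOp_pow hrev hm h2, mul_pow, Real.sq_sqrt hC0, ← pow_mul, mul_comm n]
    exact hC n

/-- The spectral gap only has to be seen on bounded functions, with constants that may depend on
the function: `L²` is the closure of the bounded functions. -/
lemma hasL2Gap_of_bounded_decay {P : Kernel 𝒳 𝒳} [IsMarkovKernel P] {π : Measure 𝒳}
    [IsProbabilityMeasure π] (hrev : P.IsReversible π) {ρ : ℝ} (hρ : 0 < ρ)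
    (H : ∀ h : 𝒳 → ℝ, Measurable h → (∃ b : ℝ, 0 < b ∧ ∀ x, |h x| ≤ b) → ∫ x, h x ∂π = 0 →
      ∃ C : ℝ, ∀ n, ∫ x, h x * kernelOp (P ^ (2 * n)) h x ∂π ≤ C * ρ ^ (2 * n)) :
    HasL2Gap P π ρ := by
  intro h hm h2 h0
  refine le_of_forall_pos_le_add fun δ hδ => ?_
  -- The approximant and its centring are each off by at most `η`; the total error is
  -- `(ρ + 1) * (2 * η) = δ`.
  set η := δ / (2 * (ρ + 1)) with hη
  have hη0 : 0 < η := by positivity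
  obtain ⟨s, hs, hs2⟩ := h2.exists_simpleFunc_eLpNorm_sub_lt (by norm_num)
    (ε := ENNReal.ofReal η) (by simpa using hη0)
  have hsm : Measurable s := s.measurable
  set c := ∫ x, s x ∂π
  have hc2 : MemLp (fun _ : 𝒳 => c) 2 π := memLp_const c
  set g : 𝒳 → ℝ := ⇑s - fun _ => c with hg
  have hgm : Measurable g := hsm.sub measurable_const
  have hg2 : MemLp g 2 π := hs2.sub hc2
  have hhs : lpNorm (h - ⇑s) 2 π ≤ η := by
    rw [← toReal_eLpNorm (h2.sub hs2).1]
    exact ENNReal.toReal_le_of_le_ofReal hη0.le hs.le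
  have hc : |c| ≤ η := by
    have : -c = ∫ x, (h - ⇑s) x * 1 ∂π := by
      simp only [mul_one, Pi.sub_apply]
      rw [integral_sub (h2.integrable (by norm_num)) (hs2.integrable (by norm_num)), h0, zero_sub]
    rw [← abs_neg, this]
    refine (abs_integral_mul_le (h2.sub hs2) (memLp_const 1)).trans ?_
    simpa using hhs
  have hhg : lpNorm (h - g) 2 π ≤ 2 * η := by
    have e : h - g = (h - ⇑s) + fun _ => c := by ext x; simp [hg]; ring
    rw [e]
    refine (lpNorm_add_le (h2.sub hs2) (by norm_num)).trans ?_
    have : lpNorm (fun _ : 𝒳 => c) 2 π = |c| := by simp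
    rw [this]
    linarith
  have hg0 : ∫ x, g x ∂π = 0 := by
    simp only [hg, Pi.sub_apply]
    rw [integral_sub (hs2.integrable (by norm_num)) (integrable_const c)]
    simp [c]
  have hgb : ∃ b : ℝ, 0 < b ∧ ∀ x, |g x| ≤ b := by
    obtain ⟨b, hb⟩ := s.exists_forall_norm_le
    refine ⟨b + |c| + 1, ?_, fun x => ?_⟩
    · have := (norm_nonneg _).trans (hb (Classical.choice π.nonempty_of_neZero))
      positivity
    · have := hb x
      rw [Real.norm_eq_abs] at this
      have h3 := abs_sub (s x) c
      simp only [hg, Pi.sub_apply]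
      linarith
  obtain ⟨C, hC⟩ := H g hgm hgb hg0
  have hPg := lpNorm_kernelOp_le_of_decay hrev hρ hgm hg2 hC
  have hKg : MemLp (kernelOp P g) 2 π := memLp_kernelOp hrev hgm (by norm_num) (by norm_num) hg2
  have hKd : lpNorm (kernelOp P h - kernelOp P g) 2 π ≤ 2 * η := by
    have e := kernelOp_sub hrev (h2.integrable (by norm_num)) (hg2.integrable (by norm_num))
    have e' : lpNorm (kernelOp P h - kernelOp P g) 2 π = lpNorm (kernelOp P (h - g)) 2 π :=
      lpNorm_congr_ae e.symm
    rw [e']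
    exact (lpNorm_kernelOp_le hrev (hm.sub hgm) (by norm_num) (by norm_num) (h2.sub hg2)).trans hhg
  have hgh : lpNorm g 2 π ≤ lpNorm h 2 π + 2 * η :=
    (lpNorm_le_lpNorm_add_lpNorm_sub h2 (by norm_num)).trans (by gcongr)
  calc lpNorm (kernelOp P h) 2 π
      ≤ lpNorm (kernelOp P g) 2 π + lpNorm (kernelOp P h - kernelOp P g) 2 π :=
        lpNorm_le_lpNorm_add_lpNorm_sub' hKg (by norm_num)
    _ ≤ ρ * lpNorm g 2 π + 2 * η := add_le_add hPg hKd
    _ ≤ ρ * (lpNorm h 2 π + 2 * η) + 2 * η := by gcongr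
    _ = ρ * lpNorm h 2 π + δ := by rw [hη]; field_simp; ring

lemma HasL2Gap.lpNorm_kernelOp_pow_le {P : Kernel 𝒳 𝒳} [IsMarkovKernel P] {π : Measure 𝒳}
    [IsProbabilityMeasure π] {ρ : ℝ} (hgap : HasL2Gap P π ρ) (hrev : P.IsReversible π)
    (hρ : 0 ≤ ρ) {h : 𝒳 → ℝ} (hm : Measurable h) (h2 : MemLp h 2 π) (h0 : ∫ x, h x ∂π = 0)
    (n : ℕ) : lpNorm (kernelOp (P ^ n) h) 2 π ≤ ρ ^ n * lpNorm h 2 π := by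
  induction n with
  | zero => simp [hm]
  | succ n ih =>
    have e := kernelOp_pow_add hrev (h2.integrable (by norm_num)) 1 n
    have e' : lpNorm (kernelOp (P ^ (n + 1)) h) 2 π =
        lpNorm (kernelOp P (kernelOp (P ^ n) h)) 2 π := by
      rw [add_comm, lpNorm_congr_ae e, pow_one]
    rw [e', pow_succ', mul_assoc]
    refine (hgap _ (measurable_kernelOp _ hm)
      (memLp_kernelOp (isReversible_pow hrev n) hm (by norm_num) (by norm_num) h2) ?_).trans ?_
    · rw [integral_kernelOp (isReversible_pow hrev n) h2, h0]
    · gcongr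

/-! ### Signed measures and the gap of a perturbed kernel -/

lemma rnDeriv_withDensityᵥ_ae_eq {π : Measure 𝒳} [IsProbabilityMeasure π] {d : 𝒳 → ℝ}
    (hd : Integrable d π) : SignedMeasure.rnDeriv (π.withDensityᵥ d) π =ᵐ[π] d :=
  (SignedMeasure.integrable_rnDeriv _ _).ae_eq_of_withDensityᵥ_eq hd
    (SignedMeasure.withDensityᵥ_rnDeriv_eq _ _ (Measure.withDensityᵥ_absolutelyContinuous _ _))

lemma memL2_withDensityᵥ {π : Measure 𝒳} [IsProbabilityMeasure π] {d : 𝒳 → ℝ}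
    (hd : MemLp d 2 π) : MemL2 π (π.withDensityᵥ d) :=
  ⟨Measure.withDensityᵥ_absolutelyContinuous _ _,
    hd.ae_eq (rnDeriv_withDensityᵥ_ae_eq (hd.integrable (by norm_num))).symm⟩

lemma l2Norm_withDensityᵥ {π : Measure 𝒳} [IsProbabilityMeasure π] {d : 𝒳 → ℝ}
    (hd : MemLp d 2 π) : l2Norm π (π.withDensityᵥ d) = lpNorm d 2 π :=
  lpNorm_congr_ae (rnDeriv_withDensityᵥ_ae_eq (hd.integrable (by norm_num)))

lemma MemL2.withDensityᵥ_rnDeriv {π : Measure 𝒳} [IsProbabilityMeasure π] {ν : SignedMeasure 𝒳}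
    (h : MemL2 π ν) : π.withDensityᵥ (ν.rnDeriv π) = ν :=
  SignedMeasure.withDensityᵥ_rnDeriv_eq _ _ h.1

lemma toSignedMeasure_eq_withDensityᵥ_one (π : Measure 𝒳) [IsProbabilityMeasure π] :
    π.toSignedMeasure = π.withDensityᵥ (fun _ => (1 : ℝ)) := by
  ext A hA
  rw [withDensityᵥ_apply (integrable_const _) hA, Measure.toSignedMeasure_apply_measurable hA]
  simp

lemma memL2_self (π : Measure 𝒳) [IsProbabilityMeasure π] : MemL2 π π.toSignedMeasure := by
  rw [toSignedMeasure_eq_withDensityᵥ_one]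
  exact memL2_withDensityᵥ (memLp_const 1)

lemma MemL2.sub {π : Measure 𝒳} [IsProbabilityMeasure π] {ν₁ ν₂ : SignedMeasure 𝒳}
    (h₁ : MemL2 π ν₁) (h₂ : MemL2 π ν₂) : MemL2 π (ν₁ - ν₂) := by
  rw [← h₁.withDensityᵥ_rnDeriv, ← h₂.withDensityᵥ_rnDeriv,
    ← withDensityᵥ_sub (SignedMeasure.integrable_rnDeriv _ _) (SignedMeasure.integrable_rnDeriv _ _)]
  exact memL2_withDensityᵥ (h₁.2.sub h₂.2)

lemma measurable_kernel_real (Q : Kernel 𝒳 𝒳) {A : Set 𝒳} (hA : MeasurableSet A) :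
    Measurable fun x => (Q x).real A :=
  (Kernel.measurable_coe Q hA).ennreal_toReal

lemma comp_real_apply (Q : Kernel 𝒳 𝒳) [IsMarkovKernel Q] (m : Measure 𝒳) {A : Set 𝒳}
    (hA : MeasurableSet A) : (Q ∘ₘ m).real A = ∫ x, (Q x).real A ∂m := by
  rw [measureReal_def, Measure.bind_apply hA Q.aemeasurable]
  exact (integral_toReal (Kernel.measurable_coe Q hA).aemeasurable
    (ae_of_all _ fun x => measure_lt_top _ _)).symm

/-- The action on signed measures may be computed from any representation as a difference of
finite measures, not only from the Jordan decomposition. -/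
lemma signedBind_sub (m₁ m₂ : Measure 𝒳) [IsFiniteMeasure m₁] [IsFiniteMeasure m₂]
    (Q : Kernel 𝒳 𝒳) [IsMarkovKernel Q] :
    signedBind (m₁.toSignedMeasure - m₂.toSignedMeasure) Q =
      (Q ∘ₘ m₁).toSignedMeasure - (Q ∘ₘ m₂).toSignedMeasure := by
  set ν := m₁.toSignedMeasure - m₂.toSignedMeasure with hν
  have hJ : ν.toJordanDecomposition.posPart.toSignedMeasure -
      ν.toJordanDecomposition.negPart.toSignedMeasure = ν :=
    SignedMeasure.toSignedMeasure_toJordanDecomposition ν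
  have e : ν.toJordanDecomposition.posPart + m₂ = m₁ + ν.toJordanDecomposition.negPart := by
    rw [← Measure.toSignedMeasure_eq_toSignedMeasure_iff, Measure.toSignedMeasure_add,
      Measure.toSignedMeasure_add, ← sub_eq_sub_iff_add_eq_add, hJ]
  have e' : Q ∘ₘ ν.toJordanDecomposition.posPart + Q ∘ₘ m₂ =
      Q ∘ₘ m₁ + Q ∘ₘ ν.toJordanDecomposition.negPart := by
    rw [← Measure.comp_add, e, Measure.comp_add]
  rw [signedBind, sub_eq_sub_iff_add_eq_add, ← Measure.toSignedMeasure_add,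
    ← Measure.toSignedMeasure_add, Measure.toSignedMeasure_eq_toSignedMeasure_iff, e']

lemma signedBind_withDensityᵥ_apply {π : Measure 𝒳} [IsProbabilityMeasure π] {d : 𝒳 → ℝ}
    (hdm : Measurable d) (hd : Integrable d π) (Q : Kernel 𝒳 𝒳) [IsMarkovKernel Q] {A : Set 𝒳}
    (hA : MeasurableSet A) :
    signedBind (π.withDensityᵥ d) Q A = ∫ x, d x * (Q x).real A ∂π := by
  have key : ∀ {u : 𝒳 → ℝ}, Measurable u → ∫ x, (Q x).real A ∂(π.withDensity fun x =>
      ENNReal.ofReal (u x)) = ∫ x, max (u x) 0 * (Q x).real A ∂π := by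
    intro u hu
    rw [integral_withDensity_eq_integral_toReal_smul (by fun_prop)
      (ae_of_all _ fun x => ENNReal.ofReal_lt_top)]
    simp [ENNReal.toReal_ofReal']
  have hint : ∀ {u : 𝒳 → ℝ}, Measurable u → Integrable u π →
      Integrable (fun x => max (u x) 0 * (Q x).real A) π := by
    intro u hum hu
    refine hu.pos_part.mul_bdd (c := 1) (measurable_kernel_real Q hA).aestronglyMeasurable
      (ae_of_all _ fun x => ?_)
    rw [Real.norm_eq_abs, abs_of_nonneg measureReal_nonneg]
    exact measureReal_le_one
  have := isFiniteMeasure_withDensity_ofReal hd.2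
  have hdn : Integrable (fun x => -d x) π := hd.neg
  have := isFiniteMeasure_withDensity_ofReal hdn.2
  have e := withDensityᵥ_eq_withDensity_pos_part_sub_withDensity_neg_part hd
  rw [e]
  erw [signedBind_sub]
  rw [sub_apply, Measure.toSignedMeasure_apply_measurable hA,
    Measure.toSignedMeasure_apply_measurable hA, comp_real_apply _ _ hA, comp_real_apply _ _ hA,
    key hdm, key (u := fun x => -d x) hdm.neg,
    ← integral_sub (hint hdm hd) (hint (u := fun x => -d x) hdm.neg hdn)]
  refine integral_congr_ae (ae_of_all _ fun x => ?_)
  dsimp only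
  rw [← sub_mul, max_zero_sub_max_neg_zero_eq_self]

lemma kernelOp_indicator_one (Q : Kernel 𝒳 𝒳) {A : Set 𝒳} (hA : MeasurableSet A) (x : 𝒳) :
    kernelOp Q (A.indicator 1) x = (Q x).real A :=
  integral_indicator_one hA

lemma integral_mul_kernel_real {Q : Kernel 𝒳 𝒳} [IsMarkovKernel Q] {π : Measure 𝒳}
    [IsProbabilityMeasure π] (h : Q.IsReversible π) {d : 𝒳 → ℝ} (hd : MemLp d 2 π) {A : Set 𝒳}
    (hA : MeasurableSet A) :
    ∫ x, d x * (Q x).real A ∂π = ∫ x in A, kernelOp Q d x ∂π := by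
  have hA2 : MemLp (A.indicator (1 : 𝒳 → ℝ)) 2 π := (memLp_const (1 : ℝ)).indicator hA
  simp only [← kernelOp_indicator_one Q hA]
  rw [integral_mul_kernelOp_comm h hd hA2, ← integral_indicator hA]
  refine integral_congr_ae (ae_of_all _ fun x => ?_)
  by_cases hx : x ∈ A <;> simp [hx]

/-- On densities with respect to a reversing measure, the action of the kernel on signed measures
is its action on functions. -/
lemma signedBind_withDensityᵥ {Q : Kernel 𝒳 𝒳} [IsMarkovKernel Q] {π : Measure 𝒳}
    [IsProbabilityMeasure π] (h : Q.IsReversible π) {d : 𝒳 → ℝ} (hdm : Measurable d)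
    (hd : MemLp d 2 π) :
    signedBind (π.withDensityᵥ d) Q = π.withDensityᵥ (kernelOp Q d) := by
  ext A hA
  rw [signedBind_withDensityᵥ_apply hdm (hd.integrable (by norm_num)) Q hA,
    integral_mul_kernel_real h hd hA, withDensityᵥ_apply _ hA]
  exact (memLp_kernelOp h hdm (by norm_num) (by norm_num) hd).integrable (by norm_num)

lemma comp_sub_eq_withDensityᵥ {Q : Kernel 𝒳 𝒳} [IsMarkovKernel Q] {π : Measure 𝒳}
    [IsProbabilityMeasure π] (h : Q.IsReversible π) {μ : Measure 𝒳} [IsFiniteMeasure μ]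
    {d : 𝒳 → ℝ} (hdm : Measurable d) (hd : MemLp d 2 π)
    (hμ : μ.toSignedMeasure - π.toSignedMeasure = π.withDensityᵥ d) :
    (Q ∘ₘ μ).toSignedMeasure - π.toSignedMeasure = π.withDensityᵥ (kernelOp Q d) := by
  rw [← signedBind_withDensityᵥ h hdm hd, ← hμ, signedBind_sub]
  congr 2
  exact (comp_eq_of_isReversible h).symm

lemma kernelOp_const_mul (Q : Kernel 𝒳 𝒳) (c : ℝ) (f : 𝒳 → ℝ) :
    kernelOp Q (fun x => c * f x) = fun x => c * kernelOp Q f x := by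
  ext x
  exact integral_const_mul _ _

/-- Geometric ergodicity of a reversible kernel on probability measures gives a spectral gap with
the same rate: a bounded mean-zero `h` is, up to scaling, the density of a probability measure
minus `1`. -/
lemma hasL2Gap_of_isL2GeomErgodic {P : Kernel 𝒳 𝒳} [IsMarkovKernel P] {π : Measure 𝒳}
    [IsProbabilityMeasure π] (hrev : P.IsReversible π) {ρ : ℝ} (hρ : 0 < ρ)
    (herg : IsL2GeomErgodic P π ρ) : HasL2Gap P π ρ := by
  refine hasL2Gap_of_bounded_decay hrev hρ fun h hm ⟨b, hb, hhb⟩ h0 => ?_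
  have h2 : MemLp h 2 π := MemLp.of_bound hm.aestronglyMeasurable b (ae_of_all _ hhb)
  set g : 𝒳 → ℝ := fun x => b⁻¹ * h x with hg
  have hgm : Measurable g := hm.const_mul _
  have hg2 : MemLp g 2 π := h2.const_mul _
  have hg1 : ∀ x, 0 ≤ 1 + g x := by
    intro x
    have h1 := (abs_le.1 (hhb x)).1
    have : b⁻¹ * (-b) ≤ b⁻¹ * h x := mul_le_mul_of_nonneg_left h1 (inv_nonneg.2 hb.le)
    rw [mul_neg, inv_mul_cancel₀ hb.ne'] at this
    simp only [hg]
    linarith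
  have hgi : Integrable (fun x => 1 + g x) π :=
    (integrable_const 1).add (hg2.integrable (by norm_num))
  have hl : ∫⁻ x, ENNReal.ofReal (1 + g x) ∂π = 1 := by
    rw [← ofReal_integral_eq_lintegral_ofReal hgi (ae_of_all _ hg1),
      integral_add (integrable_const 1) (hg2.integrable (by norm_num))]
    simp [hg, integral_const_mul, h0]
  let μ : Measure 𝒳 := π.withDensity fun x => ENNReal.ofReal (1 + g x)
  have : IsProbabilityMeasure μ := ⟨by rw [withDensity_apply _ .univ, Measure.restrict_univ, hl]⟩
  have hμ : μ.toSignedMeasure = π.withDensityᵥ (fun x => 1 + g x) := by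
    have := withDensityᵥ_toReal (μ := π) (f := fun x => ENNReal.ofReal (1 + g x))
      (by fun_prop) (by rw [hl]; simp)
    rw [← this]
    congr 1
    ext x
    rw [ENNReal.toReal_ofReal (hg1 x)]
  have hμπ : μ.toSignedMeasure - π.toSignedMeasure = π.withDensityᵥ g := by
    rw [hμ, toSignedMeasure_eq_withDensityᵥ_one, ← withDensityᵥ_sub hgi (integrable_const _)]
    congr 1
    ext x
    simp
  obtain ⟨C, hC⟩ := herg μ (by
    rw [hμ]
    exact memL2_withDensityᵥ ((memLp_const (1 : ℝ)).add hg2))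
  refine ⟨b * (lpNorm h 2 π * C), fun n => ?_⟩
  have hKg : MemLp (kernelOp (P ^ (2 * n)) g) 2 π :=
    memLp_kernelOp (isReversible_pow hrev _) hgm (by norm_num) (by norm_num) hg2
  have hn := (hC (2 * n)).2
  rw [comp_sub_eq_withDensityᵥ (isReversible_pow hrev _) hgm hg2 hμπ,
    l2Norm_withDensityᵥ hKg] at hn
  have e : ∫ x, h x * kernelOp (P ^ (2 * n)) h x ∂π =
      b * ∫ x, h x * kernelOp (P ^ (2 * n)) g x ∂π := by
    rw [← integral_const_mul, hg, kernelOp_const_mul]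
    refine integral_congr_ae (ae_of_all _ fun x => ?_)
    field_simp
  rw [e]
  calc b * ∫ x, h x * kernelOp (P ^ (2 * n)) g x ∂π
      ≤ b * (lpNorm h 2 π * lpNorm (kernelOp (P ^ (2 * n)) g) 2 π) := by
        gcongr
        exact (le_abs_self _).trans (abs_integral_mul_le h2 hKg)
    _ ≤ b * (lpNorm h 2 π * (C * ρ ^ (2 * n))) := by
        gcongr
        exact lpNorm_nonneg
    _ = b * (lpNorm h 2 π * C) * ρ ^ (2 * n) := by ring

lemma eq_withDensity_of_toSignedMeasure {π m : Measure 𝒳} [IsProbabilityMeasure π]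
    [IsFiniteMeasure m] {w : 𝒳 → ℝ} (hw : Integrable w π)
    (h : m.toSignedMeasure = π.withDensityᵥ w) :
    0 ≤ᵐ[π] w ∧ m = π.withDensity fun x => ENNReal.ofReal (w x) := by
  have hA : ∀ A, MeasurableSet A → m.real A = ∫ x in A, w x ∂π := fun A hA => by
    rw [← withDensityᵥ_apply hw hA, ← h, Measure.toSignedMeasure_apply_measurable hA]
  have hpos : 0 ≤ᵐ[π] w := ae_nonneg_of_forall_setIntegral_nonneg hw fun A hAm _ => by
    rw [← hA A hAm]; exact measureReal_nonneg
  refine ⟨hpos, Measure.ext fun A hAm => ?_⟩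
  rw [withDensity_apply _ hAm, ← ofReal_integral_eq_lintegral_ofReal hw.integrableOn
    (ae_restrict_of_ae hpos), ← hA A hAm, ofReal_measureReal]

lemma integral_eq_integral_mul_of_toSignedMeasure {π m : Measure 𝒳} [IsProbabilityMeasure π]
    [IsFiniteMeasure m] {w : 𝒳 → ℝ} (hwm : Measurable w) (hw : Integrable w π)
    (h : m.toSignedMeasure = π.withDensityᵥ w) (F : 𝒳 → ℝ) :
    ∫ x, F x ∂m = ∫ x, F x * w x ∂π := by
  obtain ⟨hpos, e⟩ := eq_withDensity_of_toSignedMeasure hw h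
  rw [e, integral_withDensity_eq_integral_toReal_smul (by fun_prop)
      (ae_of_all _ fun x => ENNReal.ofReal_lt_top)]
  refine integral_congr_ae ?_
  filter_upwards [hpos] with x hx
  rw [ENNReal.toReal_ofReal hx, smul_eq_mul, mul_comm]

lemma abs_kernelOp_le (Q : Kernel 𝒳 𝒳) [IsMarkovKernel Q] {f : 𝒳 → ℝ} {b : ℝ}
    (hb : ∀ x, |f x| ≤ b) (x : 𝒳) : |kernelOp Q f x| ≤ b := by
  have := norm_integral_le_of_norm_le_const (μ := Q x) (f := f) (C := b) (ae_of_all _ hb)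
  simpa [kernelOp] using this

/-- The gap of `P` passes to a reversible perturbation. For bounded mean-zero `h`, the signed
measures `h πε`, `h πε Q`, … lie in `L₂(π)` and shrink there by the factor `ρ + ε` at each step;
pairing with the bounded `h` turns this into decay of `∫ h Q²ⁿ h dπε`. -/
lemma hasL2Gap_of_opNormSubLE {P Q : Kernel 𝒳 𝒳} [IsMarkovKernel P] [IsMarkovKernel Q]
    {π πε : Measure 𝒳} [IsProbabilityMeasure π] [IsProbabilityMeasure πε]
    (hrev : P.IsReversible π) (hrevQ : Q.IsReversible πε) {ρ ε : ℝ} (hρ : 0 < ρ + ε)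
    (hgap : HasL2Gap P π ρ) (hε : OpNormSubLE π P Q ε) (hπε : MemL2 π πε.toSignedMeasure) :
    HasL2Gap Q πε (ρ + ε) := by
  refine hasL2Gap_of_bounded_decay hrevQ hρ fun h hm ⟨b, hb, hhb⟩ h0 => ?_
  set w := πε.toSignedMeasure.rnDeriv π with hw
  have hwm : Measurable w := SignedMeasure.measurable_rnDeriv _ _
  have hw2 : MemLp w 2 π := hπε.2
  have hint := integral_eq_integral_mul_of_toSignedMeasure hwm (hw2.integrable (by norm_num))
    hπε.withDensityᵥ_rnDeriv.symm
  -- `d n` is the density with respect to `π` of the signed measure `(h πε) Qⁿ`.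
  let k : ℕ → 𝒳 → ℝ := fun n => kernelOp (Q ^ n) h
  let d : ℕ → 𝒳 → ℝ := fun n x => k n x * w x
  have hkm : ∀ n, Measurable (k n) := fun n => measurable_kernelOp _ hm
  have hkb : ∀ n x, |k n x| ≤ b := fun n x => abs_kernelOp_le _ hhb x
  have hk2 : ∀ n, MemLp (k n) 2 πε := fun n =>
    MemLp.of_bound (hkm n).aestronglyMeasurable b (ae_of_all _ (hkb n))
  have h2 : MemLp h 2 πε := MemLp.of_bound hm.aestronglyMeasurable b (ae_of_all _ hhb)
  have h2π : MemLp h 2 π := MemLp.of_bound hm.aestronglyMeasurable b (ae_of_all _ hhb)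
  have hdm : ∀ n, Measurable (d n) := fun n => (hkm n).mul hwm
  have hd2 : ∀ n, MemLp (d n) 2 π := by
    intro n
    refine (hw2.const_mul b).mono (hdm n).aestronglyMeasurable (ae_of_all _ fun x => ?_)
    simp only [d, norm_mul, Real.norm_eq_abs, abs_of_pos hb]
    exact mul_le_mul_of_nonneg_right (hkb n x) (abs_nonneg _)
  have hd0 : ∀ n, ∫ x, d n x ∂π = 0 := fun n => by
    rw [← hint, integral_kernelOp (isReversible_pow hrevQ n) h2, h0]
  have hstep : ∀ n, signedBind (π.withDensityᵥ (d n)) Q = π.withDensityᵥ (d (n + 1)) := by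
    intro n
    ext A hA
    rw [signedBind_withDensityᵥ_apply (hdm n) ((hd2 n).integrable (by norm_num)) Q hA,
      withDensityᵥ_apply ((hd2 (n + 1)).integrable (by norm_num)) hA, ← integral_indicator hA]
    have e1 : ∀ x, d n x * (Q x).real A = k n x * (Q x).real A * w x := fun x => by
      simp only [d]; ring
    have e2 : ∀ x, A.indicator (d (n + 1)) x = A.indicator (k (n + 1)) x * w x := fun x => by
      by_cases hx : x ∈ A <;> simp [hx, d]
    simp only [e1, e2]
    rw [← hint, ← hint, integral_mul_kernel_real hrevQ (hk2 n) hA, integral_indicator hA]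
    refine setIntegral_congr_ae hA ?_
    filter_upwards [kernelOp_pow_add hrevQ (h2.integrable (by norm_num)) 1 n] with x hx _
    simp only [k]
    rw [add_comm n 1, hx, pow_one]
  have hnorm : ∀ n, lpNorm (d n) 2 π ≤ (ρ + ε) ^ n * lpNorm (d 0) 2 π := by
    intro n
    induction n with
    | zero => simp
    | succ n ih =>
      have hKd : MemLp (kernelOp P (d n)) 2 π :=
        memLp_kernelOp hrev (hdm n) (by norm_num) (by norm_num) (hd2 n)
      have h1 := (hε _ (memL2_withDensityᵥ (hd2 n))).2
      rw [hstep, signedBind_withDensityᵥ hrev (hdm n) (hd2 n),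
        ← withDensityᵥ_sub (hKd.integrable (by norm_num)) ((hd2 _).integrable (by norm_num)),
        l2Norm_withDensityᵥ (hKd.sub (hd2 _)), l2Norm_withDensityᵥ (hd2 n)] at h1
      calc lpNorm (d (n + 1)) 2 π
          ≤ lpNorm (kernelOp P (d n)) 2 π + lpNorm (kernelOp P (d n) - d (n + 1)) 2 π :=
            lpNorm_le_lpNorm_add_lpNorm_sub hKd (by norm_num)
        _ ≤ ρ * lpNorm (d n) 2 π + ε * lpNorm (d n) 2 π :=
            add_le_add (hgap _ (hdm n) (hd2 n) (hd0 n)) h1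
        _ = (ρ + ε) * lpNorm (d n) 2 π := by ring
        _ ≤ (ρ + ε) * ((ρ + ε) ^ n * lpNorm (d 0) 2 π) := by gcongr
        _ = (ρ + ε) ^ (n + 1) * lpNorm (d 0) 2 π := by ring
  refine ⟨lpNorm h 2 π * lpNorm (d 0) 2 π, fun n => ?_⟩
  calc ∫ x, h x * kernelOp (Q ^ (2 * n)) h x ∂πε = ∫ x, h x * d (2 * n) x ∂π := by
        rw [hint]; simp only [d, k, mul_assoc]
    _ ≤ lpNorm h 2 π * lpNorm (d (2 * n)) 2 π :=
        (le_abs_self _).trans (abs_integral_mul_le h2π (hd2 _))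
    _ ≤ lpNorm h 2 π * ((ρ + ε) ^ (2 * n) * lpNorm (d 0) 2 π) := by
        gcongr
        · exact lpNorm_nonneg
        · exact hnorm _
    _ = lpNorm h 2 π * lpNorm (d 0) 2 π * (ρ + ε) ^ (2 * n) := by ring

/-! ### Decay in `L⁴` -/

lemma memLp_two_mul {π : Measure 𝒳} {f g : 𝒳 → ℝ} (hf : MemLp f 4 π) (hg : MemLp g 4 π) :
    MemLp (fun x => f x * g x) 2 π := by
  have : ENNReal.HolderTriple 4 4 2 := ⟨by
    rw [← two_mul, ← ENNReal.toReal_eq_toReal_iff' (by finiteness) (by finiteness)]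
    norm_num⟩
  exact hg.mul hf

lemma sq_lpNorm_four {π : Measure 𝒳} {f : 𝒳 → ℝ} (hf : AEStronglyMeasurable f π) :
    lpNorm f 4 π ^ 2 = lpNorm (fun x => f x ^ 2) 2 π := by
  rw [← sq_eq_sq₀ (by positivity) lpNorm_nonneg,
    sq_lpNorm_two (f := fun x => f x ^ 2) (hf.pow 2), ← pow_mul,
    lpNorm_eq_integral_norm_rpow_toReal (by norm_num) (by norm_num) hf, ← Real.rpow_natCast,
    ← Real.rpow_mul (integral_nonneg fun x => by positivity)]
  norm_num
  refine integral_congr_ae (ae_of_all _ fun x => ?_)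
  have : |f x| ^ (4 : ℝ) = |f x| ^ (4 : ℕ) := by exact_mod_cast Real.rpow_natCast (|f x|) 4
  dsimp only
  rw [← pow_mul]
  exact Even.pow_abs (by decide) _

lemma sq_integral_le_integral_sq {m : Measure 𝒳} [IsProbabilityMeasure m] {f : 𝒳 → ℝ}
    (hf : MemLp f 2 m) : (∫ x, f x ∂m) ^ 2 ≤ ∫ x, f x ^ 2 ∂m := by
  have := abs_integral_mul_le hf (memLp_const (1 : ℝ))
  simp only [mul_one, lpNorm_const' (by norm_num : (2 : ENNReal) ≠ 0) (by norm_num)] at this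
  rw [← sq_lpNorm_two hf.1, ← sq_abs]
  refine pow_le_pow_left₀ (abs_nonneg _) ?_ 2
  simpa using this

lemma lpNorm_sub_integral_le {π : Measure 𝒳} [IsProbabilityMeasure π] {g : 𝒳 → ℝ}
    (hg : MemLp g 2 π) : lpNorm (g - fun _ => ∫ y, g y ∂π) 2 π ≤ lpNorm g 2 π := by
  set s := ∫ y, g y ∂π
  have hgi := hg.integrable (by norm_num : (1 : ENNReal) ≤ 2)
  refine (pow_le_pow_iff_left₀ lpNorm_nonneg lpNorm_nonneg (by norm_num : 2 ≠ 0)).1 ?_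
  rw [sq_lpNorm_two (hg.1.sub aestronglyMeasurable_const), sq_lpNorm_two hg.1]
  have e : ∀ x, (g - fun _ => s : 𝒳 → ℝ) x ^ 2 = g x ^ 2 - 2 * s * g x + s ^ 2 := fun x => by
    simp only [Pi.sub_apply]; ring
  simp only [e]
  have hgc : Integrable (fun x => 2 * s * g x) π := hgi.const_mul _
  have hgd : Integrable (fun x => g x ^ 2 - 2 * s * g x) π := hg.integrable_sq.sub hgc
  rw [integral_add hgd (integrable_const _),
    integral_sub hg.integrable_sq hgc, integral_const_mul]
  simp only [integral_const, probReal_univ, one_smul]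
  change ∫ x, g x ^ 2 ∂π - 2 * s * s + s ^ 2 ≤ _
  nlinarith [sq_nonneg s]

/-- Decay of the kernel in `L⁴`, with half of the `L²` rate. With `u = Pⁿ f`, `r = ρⁿ`,
`F = ‖f²‖₂` and `X = ‖u²‖₂`, Jensen's inequality `u² ≤ Pⁿ(f²)` gives
`X² ≤ ∫ u² Pⁿ(f²) ≤ r² F² + r F X`, so `X ≤ 2 r F`. This replaces an interpolation theorem. -/
lemma HasL2Gap.lpNorm_sq_kernelOp_pow_le {P : Kernel 𝒳 𝒳} [IsMarkovKernel P] {π : Measure 𝒳}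
    [IsProbabilityMeasure π] {ρ : ℝ} (hgap : HasL2Gap P π ρ) (hrev : P.IsReversible π)
    (hρ : 0 ≤ ρ) {f : 𝒳 → ℝ} (hm : Measurable f) (h4 : MemLp f 4 π) (h0 : ∫ x, f x ∂π = 0)
    (n : ℕ) :
    lpNorm (fun x => kernelOp (P ^ n) f x ^ 2) 2 π ≤ 2 * ρ ^ n * lpNorm (fun x => f x ^ 2) 2 π := by
  have hrn := isReversible_pow hrev n
  set K := kernelOp (P ^ n)
  have hu4 : MemLp (K f) 4 π := memLp_kernelOp hrn hm (by norm_num) (by norm_num) h4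
  have hum : Measurable (K f) := measurable_kernelOp _ hm
  have h2 : MemLp f 2 π := h4.mono_exponent (by norm_num)
  have hf2 : MemLp (fun x => f x ^ 2) 2 π := by simpa only [sq] using memLp_two_mul h4 h4
  have hu2 : MemLp (fun x => K f x ^ 2) 2 π := by simpa only [sq] using memLp_two_mul hu4 hu4
  have hf2m : Measurable (fun x => f x ^ 2) := hm.pow_const 2
  have hf2i := hf2.integrable (by norm_num : (1 : ENNReal) ≤ 2)
  set s := ∫ x, f x ^ 2 ∂π with hs
  set g : 𝒳 → ℝ := (fun x => f x ^ 2) - fun _ => s with hg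
  have hgm : Measurable g := hf2m.sub measurable_const
  have hg2 : MemLp g 2 π := hf2.sub (memLp_const s)
  have hg0 : ∫ x, g x ∂π = 0 := by
    simp only [hg, Pi.sub_apply]
    rw [integral_sub hf2i (integrable_const s)]
    simp [s]
  set F := lpNorm (fun x => f x ^ 2) 2 π with hF
  set X := lpNorm (fun x => K f x ^ 2) 2 π with hX
  set r := ρ ^ n with hr
  have hr0 : 0 ≤ r := pow_nonneg hρ n
  have hF0 : 0 ≤ F := lpNorm_nonneg
  have hX0 : 0 ≤ X := lpNorm_nonneg
  have hs0 : 0 ≤ s := integral_nonneg fun x => sq_nonneg _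
  have hsF : s ≤ F := by
    refine (pow_le_pow_iff_left₀ hs0 hF0 (by norm_num : 2 ≠ 0)).1 ?_
    rw [hF, sq_lpNorm_two hf2.1]
    exact sq_integral_le_integral_sq hf2
  have hKg : lpNorm (K g) 2 π ≤ r * F :=
    (hgap.lpNorm_kernelOp_pow_le hrev hρ hgm hg2 hg0 n).trans
      (mul_le_mul_of_nonneg_left (lpNorm_sub_integral_le hf2) hr0)
  have hKgm : MemLp (K g) 2 π := memLp_kernelOp hrn hgm (by norm_num) (by norm_num) hg2
  have hu2s : ∫ x, K f x ^ 2 ∂π ≤ r ^ 2 * s := by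
    rw [← sq_lpNorm_two hum.aestronglyMeasurable, hs, ← sq_lpNorm_two h2.1, ← mul_pow]
    exact pow_le_pow_left₀ lpNorm_nonneg (hgap.lpNorm_kernelOp_pow_le hrev hρ hm h2 h0 n) 2
  have hpt : ∀ᵐ x ∂π, (K f x ^ 2) ^ 2 ≤ s * K f x ^ 2 + K f x ^ 2 * K g x := by
    filter_upwards [kernelOp_sub hrn hf2i (integrable_const s),
      ae_integrable_kernel hrn hf2i] with x hx hxi
    have hJ : K f x ^ 2 ≤ kernelOp (P ^ n) (fun x => f x ^ 2) x :=
      sq_integral_le_integral_sq ((memLp_two_iff_integrable_sq hm.aestronglyMeasurable).2 hxi)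
    have hc : K g x = kernelOp (P ^ n) (fun x => f x ^ 2) x - s := by
      simp only [K, hg, hx, Pi.sub_apply]
      simp [kernelOp]
    rw [hc]
    nlinarith [sq_nonneg (K f x)]
  have hi1 : Integrable (fun x => s * K f x ^ 2) π := (hu2.integrable (by norm_num)).const_mul s
  have hi2 : Integrable (fun x => K f x ^ 2 * K g x) π := hu2.integrable_mul hKgm
  have hmain : X ^ 2 ≤ r ^ 2 * F ^ 2 + r * F * X := by
    calc X ^ 2 = ∫ x, (K f x ^ 2) ^ 2 ∂π := by rw [hX, sq_lpNorm_two hu2.1]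
      _ ≤ ∫ x, (s * K f x ^ 2 + K f x ^ 2 * K g x) ∂π :=
        integral_mono_ae hu2.integrable_sq (hi1.add hi2) hpt
      _ = s * ∫ x, K f x ^ 2 ∂π + ∫ x, K f x ^ 2 * K g x ∂π := by
        rw [integral_add hi1 hi2, integral_const_mul]
      _ ≤ F * (r ^ 2 * F) + X * (r * F) := by
        refine add_le_add (mul_le_mul hsF (hu2s.trans (by gcongr))
          (integral_nonneg fun x => sq_nonneg _) hF0) ?_
        exact (le_abs_self _).trans ((abs_integral_mul_le hu2 hKgm).trans (by gcongr))
      _ = r ^ 2 * F ^ 2 + r * F * X := by ring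
  by_contra! hlt
  have hrF : 0 ≤ r * F := mul_nonneg hr0 hF0
  nlinarith

/-- Lag-`n` products `f · Pⁿ f` decay in `L²` at the rate `√ρ`. -/
lemma HasL2Gap.lpNorm_mul_kernelOp_pow_le {P : Kernel 𝒳 𝒳} [IsMarkovKernel P] {π : Measure 𝒳}
    [IsProbabilityMeasure π] {ρ : ℝ} (hgap : HasL2Gap P π ρ) (hrev : P.IsReversible π)
    (hρ : 0 ≤ ρ) {f : 𝒳 → ℝ} (hm : Measurable f) (h4 : MemLp f 4 π) (h0 : ∫ x, f x ∂π = 0)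
    (n : ℕ) :
    lpNorm (fun x => f x * kernelOp (P ^ n) f x) 2 π ≤ √2 * √ρ ^ n * lpNorm f 4 π ^ 2 := by
  have hu4 : MemLp (kernelOp (P ^ n) f) 4 π :=
    memLp_kernelOp (isReversible_pow hrev n) hm (by norm_num) (by norm_num) h4
  have hf2 : MemLp (fun x => f x ^ 2) 2 π := by simpa only [sq] using memLp_two_mul h4 h4
  have hu2 : MemLp (fun x => kernelOp (P ^ n) f x ^ 2) 2 π := by
    simpa only [sq] using memLp_two_mul hu4 hu4
  refine (pow_le_pow_iff_left₀ lpNorm_nonneg (by positivity) (by norm_num : 2 ≠ 0)).1 ?_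
  rw [sq_lpNorm_two (memLp_two_mul h4 hu4).1, sq_lpNorm_four h4.1]
  calc ∫ x, (f x * kernelOp (P ^ n) f x) ^ 2 ∂π
      = ∫ x, f x ^ 2 * kernelOp (P ^ n) f x ^ 2 ∂π := by simp only [mul_pow]
    _ ≤ lpNorm (fun x => f x ^ 2) 2 π * lpNorm (fun x => kernelOp (P ^ n) f x ^ 2) 2 π :=
        (le_abs_self _).trans (abs_integral_mul_le hf2 hu2)
    _ ≤ lpNorm (fun x => f x ^ 2) 2 π * (2 * ρ ^ n * lpNorm (fun x => f x ^ 2) 2 π) :=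
        mul_le_mul_of_nonneg_left (hgap.lpNorm_sq_kernelOp_pow_le hrev hρ hm h4 h0 n) lpNorm_nonneg
    _ = (√2 * √ρ ^ n * lpNorm (fun x => f x ^ 2) 2 π) ^ 2 := by
        rw [mul_pow, mul_pow, Real.sq_sqrt (by norm_num), ← pow_mul, mul_comm n, pow_mul,
          Real.sq_sqrt hρ]
        ring

/-! ### Two-time laws of the chain and double sums -/

lemma map_compProd_prodMkLeft (lam : Measure 𝒳) [IsFiniteMeasure lam] (κ P : Kernel 𝒳 𝒳)
    [IsMarkovKernel κ] [IsMarkovKernel P] :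
    ((lam ⊗ₘ κ) ⊗ₘ P.prodMkLeft 𝒳).map (fun p => (p.1.1, p.2)) = lam ⊗ₘ (P ∘ₖ κ) := by
  have : IsFiniteMeasure (((lam ⊗ₘ κ) ⊗ₘ P.prodMkLeft 𝒳).map
    (fun p : (𝒳 × 𝒳) × 𝒳 => (p.1.1, p.2))) := Measure.isFiniteMeasure_map _ _
  refine Measure.ext_prod fun {s t} hs ht => ?_
  have e : (fun p : (𝒳 × 𝒳) × 𝒳 => (p.1.1, p.2)) ⁻¹' (s ×ˢ t) = (s ×ˢ Set.univ) ×ˢ t := by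
    ext p; simp
  rw [Measure.map_apply (by fun_prop) (hs.prod ht), e,
    Measure.compProd_apply_prod (hs.prod .univ) ht, Measure.compProd_apply_prod hs ht,
    Measure.setLIntegral_compProd (Kernel.measurable_coe _ ht) hs .univ]
  refine lintegral_congr fun x => ?_
  rw [Kernel.comp_apply' _ _ _ ht, Measure.restrict_univ]
  rfl

section Chain

variable {Ω : Type*} [MeasurableSpace Ω] {Pr : Measure Ω} [IsProbabilityMeasure Pr]
  {P : Kernel 𝒳 𝒳} [IsMarkovKernel P] {μ : Measure 𝒳} {X : ℕ → Ω → 𝒳}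

lemma IsMarkovChain.map_prodMk_eq_map_compProd (hX : IsMarkovChain Pr P μ X) (m k : ℕ) :
    Pr.map (fun ω => (X m ω, X (m + k) ω)) = Pr.map (X m) ⊗ₘ (P ^ k) := by
  have hXm := hX.measurable
  have hfin : ∀ n, IsProbabilityMeasure (Pr.map (X n)) := fun n =>
    Measure.isProbabilityMeasure_map (hXm n).aemeasurable
  induction k with
  | zero =>
    rw [pow_zero]
    change _ = Pr.map (X m) ⊗ₘ Kernel.id
    rw [Measure.compProd_id, Measure.map_map (measurable_id.prod measurable_id) (hXm m)]
    rfl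
  | succ k ih =>
    -- Keep only the coordinates `m` and `m + k` of the past in the one-step transition.
    let F : (Finset.Iic (m + k) → 𝒳) → 𝒳 × 𝒳 := fun x =>
      (x ⟨m, Finset.mem_Iic.2 (Nat.le_add_right m k)⟩, x ⟨m + k, Finset.mem_Iic.2 le_rfl⟩)
    have hF : Measurable F := by fun_prop
    have hstep : HasCondDistrib (X (m + k + 1)) (fun ω => (X m ω, X (m + k) ω))
        (P.prodMkLeft 𝒳) Pr :=
      HasCondDistrib.comp_right (Y := X (m + k + 1)) (κ := P.prodMkLeft 𝒳) (f := F) (hf := hF)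
        (Z := fun ω (i : Finset.Iic (m + k)) => X i ω) (hX.step (m + k))
    have hlaw := hstep.map_eq
    rw [ih] at hlaw
    rw [pow_succ']
    change _ = Pr.map (X m) ⊗ₘ (P ∘ₖ (P ^ k))
    rw [← map_compProd_prodMkLeft, ← hlaw, Measure.map_map (by fun_prop) (by fun_prop)]
    rfl

variable [IsProbabilityMeasure μ]

lemma IsMarkovChain.map_eq (hX : IsMarkovChain Pr P μ X) (m : ℕ) :
    Pr.map (X m) = (P ^ m : Kernel 𝒳 𝒳) ∘ₘ μ := by
  have h := hX.map_prodMk_eq_map_compProd 0 m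
  rw [hX.initial.map_eq] at h
  rw [← Measure.snd_compProd, ← h, Measure.snd, Measure.map_map measurable_snd
    ((hX.measurable _).prodMk (hX.measurable _)), zero_add]
  rfl

lemma IsMarkovChain.map_prodMk_eq_comp_compProd (hX : IsMarkovChain Pr P μ X) (m k : ℕ) :
    Pr.map (fun ω => (X m ω, X (m + k) ω)) = ((P ^ m : Kernel 𝒳 𝒳) ∘ₘ μ) ⊗ₘ (P ^ k) := by
  rw [hX.map_prodMk_eq_map_compProd, hX.map_eq]

lemma IsMarkovChain.integral_comp (hX : IsMarkovChain Pr P μ X) (m : ℕ) {F : 𝒳 → ℝ}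
    (hF : Measurable F) : ∫ ω, F (X m ω) ∂Pr = ∫ x, F x ∂((P ^ m : Kernel 𝒳 𝒳) ∘ₘ μ) := by
  rw [← hX.map_eq, integral_map (hX.measurable m).aemeasurable hF.aestronglyMeasurable]

lemma IsMarkovChain.memLp_comp (hX : IsMarkovChain Pr P μ X) {m : ℕ} {F : 𝒳 → ℝ} {p : ENNReal}
    (hF : MemLp F p ((P ^ m : Kernel 𝒳 𝒳) ∘ₘ μ)) : MemLp (fun ω => F (X m ω)) p Pr :=
  hF.comp_measurePreserving ⟨hX.measurable m, hX.map_eq m⟩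

lemma IsMarkovChain.integral_mul (hX : IsMarkovChain Pr P μ X) (m k : ℕ) {F : 𝒳 → ℝ}
    (hF : Measurable F) (h2 : ∀ n, MemLp (fun ω => F (X n ω)) 2 Pr) :
    ∫ ω, F (X m ω) * F (X (m + k) ω) ∂Pr =
      ∫ x, F x * kernelOp (P ^ k) F x ∂((P ^ m : Kernel 𝒳 𝒳) ∘ₘ μ) := by
  have hG : Measurable fun p : 𝒳 × 𝒳 => F p.1 * F p.2 := by fun_prop
  have hpair : Measurable fun ω => (X m ω, X (m + k) ω) :=
    (hX.measurable _).prodMk (hX.measurable _)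
  have hint : Integrable (fun p : 𝒳 × 𝒳 => F p.1 * F p.2) (((P ^ m : Kernel 𝒳 𝒳) ∘ₘ μ) ⊗ₘ (P ^ k)) := by
    rw [← hX.map_prodMk_eq_comp_compProd, integrable_map_measure hG.aestronglyMeasurable hpair.aemeasurable]
    exact (h2 m).integrable_mul (h2 (m + k))
  calc ∫ ω, F (X m ω) * F (X (m + k) ω) ∂Pr
      = ∫ p, F p.1 * F p.2 ∂(((P ^ m : Kernel 𝒳 𝒳) ∘ₘ μ) ⊗ₘ (P ^ k)) := by
        rw [← hX.map_prodMk_eq_comp_compProd, integral_map hpair.aemeasurable hG.aestronglyMeasurable]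
    _ = _ := by
        rw [Measure.integral_compProd hint]
        refine integral_congr_ae (ae_of_all _ fun x => ?_)
        dsimp only [kernelOp]
        rw [integral_const_mul]

end Chain

lemma integrable_of_toSignedMeasure {π m : Measure 𝒳} [IsProbabilityMeasure π]
    [IsFiniteMeasure m] {w : 𝒳 → ℝ} (hwm : Measurable w) (hw : MemLp w 2 π)
    (h : m.toSignedMeasure = π.withDensityᵥ w) {F : 𝒳 → ℝ} (hF : MemLp F 2 π) :
    Integrable F m := by
  obtain ⟨hpos, e⟩ := eq_withDensity_of_toSignedMeasure (hw.integrable (by norm_num)) h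
  rw [e, integrable_withDensity_iff_integrable_smul' (by fun_prop)
      (ae_of_all _ fun x => ENNReal.ofReal_lt_top)]
  refine (hw.integrable_mul hF).congr ?_
  filter_upwards [hpos] with x hx
  simp [ENNReal.toReal_ofReal hx]

/-- A symmetric double sum is at most twice the sum over starting times `m` and lags `k`. -/
lemma sum_sum_le_two_mul {e b : ℕ → ℕ → ℝ} (hsymm : ∀ m n, e m n = e n m)
    (hb : ∀ m k, 0 ≤ b m k) (he : ∀ m k, e m (m + k) ≤ b m k) (t : ℕ) :
    ∑ m ∈ Finset.range t, ∑ n ∈ Finset.range t, e m n ≤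
      2 * ∑ m ∈ Finset.range t, ∑ k ∈ Finset.range t, b m k := by
  let c : ℕ → ℕ → ℝ := fun m n => if m ≤ n then b m (n - m) else 0
  have hc : ∀ m n, 0 ≤ c m n := fun m n => by
    simp only [c]; split_ifs; exacts [hb _ _, le_rfl]
  have hec : ∀ m n, m ≤ n → e m n ≤ c m n := fun m n h => by
    simp only [c, if_pos h]
    simpa [Nat.add_sub_cancel' h] using he m (n - m)
  have hle : ∀ m n, e m n ≤ c m n + c n m := fun m n => by
    rcases le_total m n with h | h
    · linarith [hec m n h, hc n m]
    · rw [hsymm]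
      linarith [hec n m h, hc m n]
  have hrow : ∀ m ∈ Finset.range t, ∑ n ∈ Finset.range t, c m n ≤
      ∑ k ∈ Finset.range t, b m k := by
    intro m _
    have e1 : ∑ n ∈ Finset.range t, c m n = ∑ n ∈ Finset.Ico m t, b m (n - m) := by
      rw [← Finset.sum_filter]
      congr 1
      ext n
      simp [and_comm]
    rw [e1, Finset.sum_Ico_eq_sum_range]
    simp only [Nat.add_sub_cancel_left]
    exact Finset.sum_le_sum_of_subset_of_nonneg
      (Finset.range_subset_range.2 (Nat.sub_le _ _)) fun k _ _ => hb m k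
  have hsum := Finset.sum_le_sum hrow
  calc ∑ m ∈ Finset.range t, ∑ n ∈ Finset.range t, e m n
      ≤ ∑ m ∈ Finset.range t, ∑ n ∈ Finset.range t, (c m n + c n m) :=
        Finset.sum_le_sum fun m _ => Finset.sum_le_sum fun n _ => hle m n
    _ = ∑ m ∈ Finset.range t, ∑ n ∈ Finset.range t, c m n +
        ∑ m ∈ Finset.range t, ∑ n ∈ Finset.range t, c m n := by
        simp only [Finset.sum_add_distrib]
        rw [Finset.sum_comm (f := fun m n => c n m)]
    _ ≤ _ := by linarith

lemma geom_sum_le_inv {q : ℝ} (h0 : 0 ≤ q) (h1 : q < 1) (t : ℕ) :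
    ∑ k ∈ Finset.range t, q ^ k ≤ 1 / (1 - q) := by
  rw [le_div_iff₀ (by linarith), geom_sum_mul_neg]
  linarith [pow_nonneg h0 t]

/-- Since `α = (1 - √(1 - α)) (1 + √(1 - α))`, decay at half the rate costs only a factor `2`. -/
lemma geom_sum_sqrt_le {α : ℝ} (h0 : 0 < α) (h1 : α < 1) (t : ℕ) :
    ∑ k ∈ Finset.range t, √(1 - α) ^ k ≤ 2 / α := by
  have hs : √(1 - α) ^ 2 = 1 - α := Real.sq_sqrt (by linarith)
  have hs1 : √(1 - α) < 1 := by
    rw [Real.sqrt_lt' one_pos]; linarith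
  refine (geom_sum_le_inv (Real.sqrt_nonneg _) hs1 t).trans ?_
  rw [div_le_div_iff₀ (by linarith) h0]
  nlinarith [Real.sqrt_nonneg (1 - α)]

lemma sum_sum_geom_le {α A B : ℝ} (h0 : 0 < α) (h1 : α < 1) (hA : 0 ≤ A) (hB : 0 ≤ B) (t : ℕ) :
    ∑ m ∈ Finset.range t, ∑ k ∈ Finset.range t,
      (A * (1 - α) ^ k + B * ((1 - α) ^ m * √(1 - α) ^ k)) ≤ A * t / α + 2 * B / α ^ 2 := by
  have hg := geom_sum_le_inv (q := 1 - α) (by linarith) (by linarith) t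
  rw [sub_sub_cancel] at hg
  have hs := geom_sum_sqrt_le h0 h1 t
  have hg0 : 0 ≤ ∑ k ∈ Finset.range t, (1 - α) ^ k :=
    Finset.sum_nonneg fun k _ => pow_nonneg (by linarith) k
  have e : ∑ m ∈ Finset.range t, ∑ k ∈ Finset.range t,
      (A * (1 - α) ^ k + B * ((1 - α) ^ m * √(1 - α) ^ k)) =
      A * (t * ∑ k ∈ Finset.range t, (1 - α) ^ k) +
      B * ((∑ m ∈ Finset.range t, (1 - α) ^ m) * ∑ k ∈ Finset.range t, √(1 - α) ^ k) := by
    simp only [Finset.sum_add_distrib, ← Finset.mul_sum, Finset.sum_const, Finset.card_range,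
      nsmul_eq_mul, Finset.sum_mul]
  rw [e]
  have hmul : (∑ m ∈ Finset.range t, (1 - α) ^ m) * ∑ k ∈ Finset.range t, √(1 - α) ^ k ≤
      1 / α * (2 / α) := mul_le_mul hg hs (Finset.sum_nonneg fun k _ => by positivity)
        (by positivity)
  calc _ ≤ A * (t * (1 / α)) + B * (1 / α * (2 / α)) := by gcongr
    _ = A * t / α + 2 * B / α ^ 2 := by field_simp

/-! ### The covariance bound -/

section Bound

variable {Ω : Type*} [MeasurableSpace Ω] {Pr : Measure Ω} [IsProbabilityMeasure Pr]
  {P : Kernel 𝒳 𝒳} [IsMarkovKernel P] {π μ : Measure 𝒳} [IsProbabilityMeasure π]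
  [IsProbabilityMeasure μ] {X : ℕ → Ω → 𝒳}

/-- The law of the chain at time `m` has density `1 + Pᵐ h`, where `1 + h` is the initial
density. -/
lemma toSignedMeasure_comp_pow (hrev : P.IsReversible π) {h : 𝒳 → ℝ} (hm : Measurable h)
    (h2 : MemLp h 2 π) (hμ : μ.toSignedMeasure - π.toSignedMeasure = π.withDensityᵥ h) (m : ℕ) :
    ((P ^ m : Kernel 𝒳 𝒳) ∘ₘ μ).toSignedMeasure =
      π.withDensityᵥ (fun x => 1 + kernelOp (P ^ m) h x) := by
  have hK : MemLp (kernelOp (P ^ m) h) 2 π :=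
    memLp_kernelOp (isReversible_pow hrev m) hm (by norm_num) (by norm_num) h2
  have e := comp_sub_eq_withDensityᵥ (isReversible_pow hrev m) hm h2 hμ
  rw [withDensityᵥ_add' (integrable_const _) (hK.integrable (by norm_num)), ← e,
    ← toSignedMeasure_eq_withDensityᵥ_one]
  abel

/-- The product moment at times `m` and `m + k`: a stationary part that decays in the lag, and a
correction for the initial law that decays in `m` and, at half the rate, in the lag. -/
lemma integral_chain_mul_le (hrev : P.IsReversible π) {ρ : ℝ} (hρ : 0 ≤ ρ) (hgap : HasL2Gap P π ρ)
    (hX : IsMarkovChain Pr P μ X) {h : 𝒳 → ℝ} (hm : Measurable h) (h2 : MemLp h 2 π)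
    (h0 : ∫ x, h x ∂π = 0) (hμ : μ.toSignedMeasure - π.toSignedMeasure = π.withDensityᵥ h)
    {f : 𝒳 → ℝ} (hfm : Measurable f) (hf4 : MemLp f 4 π) (hf0 : ∫ x, f x ∂π = 0)
    (hfX : ∀ n, MemLp (fun ω => f (X n ω)) 2 Pr) (m k : ℕ) :
    ∫ ω, f (X m ω) * f (X (m + k) ω) ∂Pr ≤
      lpNorm f 2 π ^ 2 * ρ ^ k +
        √2 * lpNorm h 2 π * lpNorm f 4 π ^ 2 * (ρ ^ m * √ρ ^ k) := by
  have hf2 : MemLp f 2 π := hf4.mono_exponent (by norm_num)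
  have hK : MemLp (kernelOp (P ^ m) h) 2 π :=
    memLp_kernelOp (isReversible_pow hrev m) hm (by norm_num) (by norm_num) h2
  have hu4 : MemLp (kernelOp (P ^ k) f) 4 π :=
    memLp_kernelOp (isReversible_pow hrev k) hfm (by norm_num) (by norm_num) hf4
  have hu2 : MemLp (kernelOp (P ^ k) f) 2 π := hu4.mono_exponent (by norm_num)
  have hfu : MemLp (fun x => f x * kernelOp (P ^ k) f x) 2 π := memLp_two_mul hf4 hu4
  have hlaw := toSignedMeasure_comp_pow (P := P) hrev hm h2 hμ m
  have hwm : Measurable fun x => 1 + kernelOp (P ^ m) h x :=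
    measurable_const.add (measurable_kernelOp _ hm)
  rw [hX.integral_mul m k hfm hfX, integral_eq_integral_mul_of_toSignedMeasure hwm
    ((integrable_const 1).add (hK.integrable (by norm_num))) hlaw]
  simp only [mul_add, mul_one]
  have hi : Integrable (fun x => f x * kernelOp (P ^ k) f x * kernelOp (P ^ m) h x) π :=
    hfu.integrable_mul hK
  rw [integral_add (hfu.integrable (by norm_num)) hi]
  refine add_le_add ?_ ?_
  · calc ∫ x, f x * kernelOp (P ^ k) f x ∂π
        ≤ lpNorm f 2 π * lpNorm (kernelOp (P ^ k) f) 2 π :=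
          (le_abs_self _).trans (abs_integral_mul_le hf2 hu2)
      _ ≤ lpNorm f 2 π * (ρ ^ k * lpNorm f 2 π) :=
          mul_le_mul_of_nonneg_left (hgap.lpNorm_kernelOp_pow_le hrev hρ hfm hf2 hf0 k)
            lpNorm_nonneg
      _ = lpNorm f 2 π ^ 2 * ρ ^ k := by ring
  · calc ∫ x, f x * kernelOp (P ^ k) f x * kernelOp (P ^ m) h x ∂π
        ≤ lpNorm (fun x => f x * kernelOp (P ^ k) f x) 2 π * lpNorm (kernelOp (P ^ m) h) 2 π :=
          (le_abs_self _).trans (abs_integral_mul_le hfu hK)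
      _ ≤ (√2 * √ρ ^ k * lpNorm f 4 π ^ 2) * (ρ ^ m * lpNorm h 2 π) :=
          mul_le_mul (hgap.lpNorm_mul_kernelOp_pow_le hrev hρ hfm hf4 hf0 k)
            (hgap.lpNorm_kernelOp_pow_le hrev hρ hm h2 h0 m) lpNorm_nonneg (by positivity)
      _ = √2 * lpNorm h 2 π * lpNorm f 4 π ^ 2 * (ρ ^ m * √ρ ^ k) := by ring

/-- The density of a difference of probability measures in `L₂(π)` has mean zero. -/
lemma integral_rnDeriv_sub_eq_zero
    (hμ : MemL2 π (μ.toSignedMeasure - π.toSignedMeasure)) :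
    ∫ x, (μ.toSignedMeasure - π.toSignedMeasure).rnDeriv π x ∂π = 0 := by
  rw [← setIntegral_univ, ← withDensityᵥ_apply (SignedMeasure.integrable_rnDeriv _ _) .univ,
    hμ.withDensityᵥ_rnDeriv, sub_apply, Measure.toSignedMeasure_apply_measurable .univ,
    Measure.toSignedMeasure_apply_measurable .univ]
  simp

lemma memLp_and_sum_covariance_le_of_measurable (hrev : P.IsReversible π) {α : ℝ} (hα0 : 0 < α)
    (hα1 : α < 1) (hgap : HasL2Gap P π (1 - α)) (hX : IsMarkovChain Pr P μ X)
    (hμ : MemL2 π μ.toSignedMeasure) {f : 𝒳 → ℝ} (hfm : Measurable f) (hf : MemLp f 4 π)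
    {t : ℕ} (ht : 1 ≤ t) :
    (∀ m : ℕ, MemLp (fun ω => f (X m ω)) 2 Pr) ∧
      1 / (t : ℝ) ^ 2 * ∑ m ∈ Finset.range t, ∑ n ∈ Finset.range t,
          covariance (fun ω => f (X m ω)) (fun ω => f (X n ω)) Pr
        ≤ 2 * lpNorm (fun x => f x - ∫ y, f y ∂π) 2 π ^ 2 / (α * t)
          + (2 : ℝ) ^ (7 / 2 : ℝ)
              * l2Norm π (μ.toSignedMeasure - π.toSignedMeasure)
              * lpNorm (fun x => f x - ∫ y, f y ∂π) 4 π ^ 2 / (α ^ 2 * (t : ℝ) ^ 2)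
          - (1 / (t : ℝ) * (∑ m ∈ Finset.range t, ∫ x, f x ∂((P ^ m) ∘ₘ μ))
              - ∫ x, f x ∂π) ^ 2 := by
  set c := ∫ y, f y ∂π with hc
  set g : 𝒳 → ℝ := fun x => f x - c with hg
  have hdiff : MemL2 π (μ.toSignedMeasure - π.toSignedMeasure) := hμ.sub (memL2_self π)
  set h := (μ.toSignedMeasure - π.toSignedMeasure).rnDeriv π with hh
  have hhm : Measurable h := SignedMeasure.measurable_rnDeriv _ _
  have hh2 : MemLp h 2 π := hdiff.2
  have hh0 : ∫ x, h x ∂π = 0 := integral_rnDeriv_sub_eq_zero hdiff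
  have hμh : μ.toSignedMeasure - π.toSignedMeasure = π.withDensityᵥ h :=
    hdiff.withDensityᵥ_rnDeriv.symm
  have hgm : Measurable g := hfm.sub measurable_const
  have hg4 : MemLp g 4 π := hf.sub (memLp_const c)
  have hg0 : ∫ x, g x ∂π = 0 := by
    rw [integral_sub (hf.integrable (by norm_num)) (integrable_const c)]
    simp [hc]
  have hL2 : ∀ F : 𝒳 → ℝ, Measurable F → MemLp F 4 π → ∀ m : ℕ,
      MemLp (fun ω => F (X m ω)) 2 Pr := by
    intro F hF hF4 m
    refine hX.memLp_comp ((memLp_two_iff_integrable_sq hF.aestronglyMeasurable).2 ?_)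
    refine integrable_of_toSignedMeasure (measurable_const.add (measurable_kernelOp _ hhm))
      ((memLp_const (1 : ℝ)).add
        (memLp_kernelOp (isReversible_pow hrev m) hhm (by norm_num) (by norm_num) hh2))
      (toSignedMeasure_comp_pow hrev hhm hh2 hμh m) ?_
    simpa only [sq] using memLp_two_mul hF4 hF4
  have hfX := hL2 f hfm hf
  have hgX := hL2 g hgm hg4
  refine ⟨hfX, ?_⟩
  have hmean : ∀ m, ∫ ω, g (X m ω) ∂Pr = ∫ x, f x ∂((P ^ m : Kernel 𝒳 𝒳) ∘ₘ μ) - c := by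
    intro m
    simp only [hg]
    rw [integral_sub ((hfX m).integrable (by norm_num)) (integrable_const c),
      hX.integral_comp m hfm]
    simp
  have hcov : ∀ m n, covariance (fun ω => f (X m ω)) (fun ω => f (X n ω)) Pr =
      ∫ ω, g (X m ω) * g (X n ω) ∂Pr -
        (∫ ω, g (X m ω) ∂Pr) * ∫ ω, g (X n ω) ∂Pr := by
    intro m n
    rw [← covariance_sub_const_left ((hfX m).integrable (by norm_num)) c,
      ← covariance_sub_const_right ((hfX n).integrable (by norm_num)) c]
    exact covariance_eq_sub (hgX m) (hgX n)
  set A := lpNorm g 2 π ^ 2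
  set B := √2 * lpNorm h 2 π * lpNorm g 4 π ^ 2 with hB
  have hB0 : 0 ≤ B := by
    have : 0 ≤ lpNorm h 2 π := lpNorm_nonneg
    positivity
  have hmom : ∑ m ∈ Finset.range t, ∑ n ∈ Finset.range t, ∫ ω, g (X m ω) * g (X n ω) ∂Pr ≤
      2 * (A * t / α + 2 * B / α ^ 2) := by
    refine (sum_sum_le_two_mul (fun m n => by simp only [mul_comm]) (fun m k => ?_)
      (integral_chain_mul_le hrev (by linarith) hgap hX hhm hh2 hh0 hμh hgm hg4 hg0 hgX) t).trans
      (mul_le_mul_of_nonneg_left (sum_sum_geom_le hα0 hα1 (sq_nonneg _) hB0 t) zero_le_two)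
    have : 0 ≤ 1 - α := by linarith
    positivity
  have ht0 : (0 : ℝ) < t := by exact_mod_cast ht
  have hsq : ∑ m ∈ Finset.range t, ∑ n ∈ Finset.range t,
      (∫ ω, g (X m ω) ∂Pr) * ∫ ω, g (X n ω) ∂Pr =
      t ^ 2 * (1 / (t : ℝ) * (∑ m ∈ Finset.range t, ∫ x, f x ∂((P ^ m : Kernel 𝒳 𝒳) ∘ₘ μ))
        - c) ^ 2 := by
    rw [← Finset.sum_mul_sum]
    simp only [hmean, Finset.sum_sub_distrib, Finset.sum_const, Finset.card_range, nsmul_eq_mul]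
    field_simp
  have h72 : (2 : ℝ) ^ (7 / 2 : ℝ) = 8 * √2 := by
    rw [show (7 / 2 : ℝ) = 3 + 1 / 2 by norm_num, Real.rpow_add two_pos, ← Real.sqrt_eq_rpow]
    norm_num
  have hnorm : l2Norm π (μ.toSignedMeasure - π.toSignedMeasure) = lpNorm h 2 π := rfl
  simp only [hcov, Finset.sum_sub_distrib]
  rw [hsq, mul_sub, h72, hnorm]
  refine sub_le_sub ?_ (le_of_eq (by field_simp))
  calc 1 / (t : ℝ) ^ 2 * ∑ m ∈ Finset.range t, ∑ n ∈ Finset.range t,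
        ∫ ω, g (X m ω) * g (X n ω) ∂Pr
      ≤ 1 / (t : ℝ) ^ 2 * (2 * (A * t / α + 2 * B / α ^ 2)) := by gcongr
    _ = 2 * A / (α * t) + 4 * B / (α ^ 2 * t ^ 2) := by field_simp; ring
    _ ≤ 2 * A / (α * t) + 8 * B / (α ^ 2 * t ^ 2) := by gcongr; norm_num
    _ = _ := by rw [hB]; ring

/-- The covariance bound for a reversible kernel with spectral gap `α`. Only the class of `f`
modulo `π`-null sets matters, since every `X m` has a law absolutely continuous with respect
to `π`. -/
lemma memLp_and_sum_covariance_le (hrev : P.IsReversible π) {α : ℝ} (hα0 : 0 < α)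
    (hα1 : α < 1) (hgap : HasL2Gap P π (1 - α)) (hX : IsMarkovChain Pr P μ X)
    (hμ : MemL2 π μ.toSignedMeasure) {f : 𝒳 → ℝ} (hf : MemLp f 4 π)
    {t : ℕ} (ht : 1 ≤ t) :
    (∀ m : ℕ, MemLp (fun ω => f (X m ω)) 2 Pr) ∧
      1 / (t : ℝ) ^ 2 * ∑ m ∈ Finset.range t, ∑ n ∈ Finset.range t,
          covariance (fun ω => f (X m ω)) (fun ω => f (X n ω)) Pr
        ≤ 2 * lpNorm (fun x => f x - ∫ y, f y ∂π) 2 π ^ 2 / (α * t)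
          + (2 : ℝ) ^ (7 / 2 : ℝ)
              * l2Norm π (μ.toSignedMeasure - π.toSignedMeasure)
              * lpNorm (fun x => f x - ∫ y, f y ∂π) 4 π ^ 2 / (α ^ 2 * (t : ℝ) ^ 2)
          - (1 / (t : ℝ) * (∑ m ∈ Finset.range t, ∫ x, f x ∂((P ^ m) ∘ₘ μ))
              - ∫ x, f x ∂π) ^ 2 := by
  obtain ⟨f', hf'm, hff'⟩ := hf.1.aemeasurable
  have hf' : MemLp f' 4 π := hf.ae_eq hff'
  have hac0 : μ ≪ π := by
    have e := (eq_withDensity_of_toSignedMeasure (hμ.2.integrable (by norm_num))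
      hμ.withDensityᵥ_rnDeriv.symm).2
    rw [e]
    exact withDensity_absolutelyContinuous _ _
  have hac : ∀ m : ℕ, (P ^ m : Kernel 𝒳 𝒳) ∘ₘ μ ≪ π := fun m => by
    have := hac0.comp_right (P ^ m)
    rwa [comp_eq_of_isReversible (isReversible_pow hrev m)] at this
  have hlaw : ∀ m : ℕ, f =ᵐ[(P ^ m : Kernel 𝒳 𝒳) ∘ₘ μ] f' := fun m => (hac m).ae_eq hff'
  have hchain : ∀ m : ℕ, (fun ω => f (X m ω)) =ᵐ[Pr] fun ω => f' (X m ω) := fun m => by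
    have h1 := hlaw m
    rw [← hX.map_eq] at h1
    exact ae_of_ae_map (hX.measurable m).aemeasurable h1
  obtain ⟨hL2, hle⟩ :=
    memLp_and_sum_covariance_le_of_measurable hrev hα0 hα1 hgap hX hμ hf'm hf' ht
  refine ⟨fun m => (hL2 m).ae_eq (hchain m).symm, ?_⟩
  have hcov : ∀ m n : ℕ, covariance (fun ω => f (X m ω)) (fun ω => f (X n ω)) Pr =
      covariance (fun ω => f' (X m ω)) (fun ω => f' (X n ω)) Pr := by
    intro m n
    rw [covariance, covariance, integral_congr_ae (hchain m), integral_congr_ae (hchain n)]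
    refine integral_congr_ae ?_
    filter_upwards [hchain m, hchain n] with ω h1 h2
    rw [h1, h2]
  have hcent : (fun x => f x - ∫ y, f' y ∂π) =ᵐ[π] fun x => f' x - ∫ y, f' y ∂π := by
    filter_upwards [hff'] with x hx
    rw [hx]
  simp only [hcov, integral_congr_ae hff', integral_congr_ae (hlaw _), lpNorm_congr_ae hcent]
  exact hle

end Bound

end PerturbedChain

end

theorem mainTheorem10 {𝒳 : Type*} [MeasurableSpace 𝒳] [MeasurableSpace.CountablyGenerated 𝒳]
    {Ω : Type*} [MeasurableSpace Ω] (Pr : Measure Ω) [IsProbabilityMeasure Pr]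
    (P : Kernel 𝒳 𝒳) [IsMarkovKernel P] (π : Measure 𝒳) [IsProbabilityMeasure π]
    (hrev : P.IsReversible π) (α : ℝ) (hα0 : 0 < α) (hα1 : α < 1)
    (herg : PerturbedChain.IsL2GeomErgodic P π (1 - α)) :
    (∀ (μ : Measure 𝒳) [IsProbabilityMeasure μ] (X : ℕ → Ω → 𝒳) (f : 𝒳 → ℝ) (t : ℕ),
      PerturbedChain.MemL2 π μ.toSignedMeasure →
      PerturbedChain.IsMarkovChain Pr P μ X →
      MemLp f 4 π →
      1 ≤ t →
      (∀ m : ℕ, MemLp (fun ω => f (X m ω)) 2 Pr) ∧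
      1 / (t : ℝ) ^ 2 * ∑ m ∈ Finset.range t, ∑ n ∈ Finset.range t,
          covariance (fun ω => f (X m ω)) (fun ω => f (X n ω)) Pr
        ≤ 2 * lpNorm (fun x => f x - ∫ y, f y ∂π) 2 π ^ 2 / (α * t)
          + (2 : ℝ) ^ (7 / 2 : ℝ)
              * PerturbedChain.l2Norm π (μ.toSignedMeasure - π.toSignedMeasure)
              * lpNorm (fun x => f x - ∫ y, f y ∂π) 4 π ^ 2 / (α ^ 2 * (t : ℝ) ^ 2)
          - (1 / (t : ℝ) * (∑ m ∈ Finset.range t, ∫ x, f x ∂((P ^ m) ∘ₘ μ))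
              - ∫ x, f x ∂π) ^ 2) ∧
    (∀ (Pε : Kernel 𝒳 𝒳) [IsMarkovKernel Pε] (πε : Measure 𝒳) [IsProbabilityMeasure πε] (ε : ℝ),
      0 < ε →
      PerturbedChain.OpNormSubLE π P Pε ε →
      Pε.Invariant πε →
      πε ≪ π →
      ε < α →
      π ≪ πε →
      PerturbedChain.MemL2 π πε.toSignedMeasure →
      Pε.IsReversible πε →
      ∀ (ν : Measure 𝒳) [IsProbabilityMeasure ν] (X : ℕ → Ω → 𝒳) (g : 𝒳 → ℝ) (t : ℕ),
      PerturbedChain.MemL2 πε ν.toSignedMeasure →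
      PerturbedChain.IsMarkovChain Pr Pε ν X →
      MemLp g 4 πε →
      1 ≤ t →
      (∀ m : ℕ, MemLp (fun ω => g (X m ω)) 2 Pr) ∧
      1 / (t : ℝ) ^ 2 * ∑ m ∈ Finset.range t, ∑ n ∈ Finset.range t,
          covariance (fun ω => g (X m ω)) (fun ω => g (X n ω)) Pr
        ≤ 2 * lpNorm (fun x => g x - ∫ y, g y ∂πε) 2 πε ^ 2 / ((α - ε) * t)
          + (2 : ℝ) ^ (7 / 2 : ℝ)
              * PerturbedChain.l2Norm πε (ν.toSignedMeasure - πε.toSignedMeasure)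
              * lpNorm (fun x => g x - ∫ y, g y ∂πε) 4 πε ^ 2 / ((α - ε) ^ 2 * (t : ℝ) ^ 2)
          - (1 / (t : ℝ) * (∑ m ∈ Finset.range t, ∫ x, g x ∂((Pε ^ m) ∘ₘ ν))
              - ∫ x, g x ∂πε) ^ 2) := by
  have hgap : PerturbedChain.HasL2Gap P π (1 - α) :=
    PerturbedChain.hasL2Gap_of_isL2GeomErgodic hrev (by linarith) herg
  refine ⟨fun μ _ X f t hμ hX hf ht =>
    PerturbedChain.memLp_and_sum_covariance_le hrev hα0 hα1 hgap hX hμ hf ht, ?_⟩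
  intro Pε _ πε _ ε hε0 hop _ _ hεα _ hπε hrevε ν _ X g t hν hX hg ht
  have hgapε := PerturbedChain.hasL2Gap_of_opNormSubLE hrev hrevε (by linarith) hgap hop hπε
  rw [show 1 - α + ε = 1 - (α - ε) by ring] at hgapε
  exact PerturbedChain.memLp_and_sum_covariance_le hrevε (by linarith) (by linarith) hgapε hX hν
    hg ht
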